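/- Let $k\ge 2$ be an integer and let $H_k$ be the following graph. Take four disjoint triangles $A_1,A_2,B_1,B_2$, each with nodes labelled $1,2,3$; join node $1$ of $A_1$ to node $1$ of $A_2$ and node $1$ of $B_1$ to node $1$ of $B_2$ by an edge; and for $i=1,2$ join node $2$ of $A_i$ to node $2$ of $B_i$ by $k$ internally disjoint paths of length $3$. ($H_k$-detection, respectively induced $H_k$-detection, asks whether an input graph $G$ contains $H_k$ as a subgraph, respectively as an induced subgraph.) Then the following hold. 1. $H_k$ is a (two-terminal) series-parallel graph and has treewidth exactly $2$. 2. There are functions $m,C:\mathbb N\to\mathbb N$ with $m(n)=\Theta(n^2)$ and $C(n)=\Theta(n^{1/k})$ and $n$-node graphs $G(n,x_0,x_1)$, for $n \in \mathbb N$ and $x_0,x_1\in\{0,1\}^{m(n)}$, such that for all sufficiently large $n$: for all $x_0,x_1$, the graph $G(n,x_0,x_1)$ contains no copy of $H_k$ if and only if it contains no induced copy of $H_k$, if and only if $\mathsf{DISJ}_{m(n)}(x_0,x_1)=1$ (that is, there is no $i$ with $x_0(i)=x_1(i)=1$); and $G(n,x_0,x_1)=(V_0\cup V_1,\,E_0\cup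 E_1\cup S)$, where $V_0,V_1$ are disjoint with $|V_0\cup V_1|=n$, the edges $E_i$ lie inside $V_i$ and depend only on $n$ and $x_i$, and $S$ consists of exactly $C(n)$ edges between $V_0$ and $V_1$; here $V_0,V_1,S$ depend only on $n$. 3. There are $c>0$ and $n_0$, depending only on $k$, such that for all $n\ge n_0$ and all $b,T \in \mathbb N$: if some CONGEST algorithm with messages of at most $b$ bits per edge, direction and round solves $H_k$-detection, or induced $H_k$-detection, in $T$ rounds on all $n$-node graphs, then $T\cdot b\ge c\,n^{2-1/k}$. This holds for deterministic algorithms and for randomized algorithms (even with shared randomness) that are correct with probability at least $2/3$ on every input graph. An algorithm answers yes if at least one node reports yes; nodes have unrestricted local computation and know $n$, their identifiers from $\{1, \dots, n\}$, and the identifiers of their neighbours. 4. In particular, for each $\beta>0$ there are $c>0$ and $n_0$, depending only on $k$ and $\beta$, such that for all $n\ge n_0$ every such deterministic or randomized CONGEST algorithm with bandwidth at most $\beta\log n$ needs at least $c\,n^{2-1/k}/\log n$ rounds. That is, both $H_k$-detection and induced $H_k$-detection need $\Omega(n^{2-1/k}/\log n)$ rounds. -/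

import Mathlib

open Filter Asymptotics MeasureTheory
open scoped ENNReal

namespace SimpleGraph

variable {V : Type*}

/-- A tree decomposition of `G` with bags indexed by the nodes of a tree on `ι`. -/
structure TreeDecomposition (G : SimpleGraph V) (ι : Type) where
  tree : SimpleGraph ι
  isTree : tree.IsTree
  bag : ι → Finset V
  vertex_mem : ∀ v : V, ∃ i, v ∈ bag i
  edge_mem : ∀ u v : V, G.Adj u v → ∃ i, u ∈ bag i ∧ v ∈ bag i
  path_mem : ∀ (i l : ι) (p : tree.Walk i l), p.IsPath → ∀ j ∈ p.support,
    ∀ v, v ∈ bag i → v ∈ bag l → v ∈ bag j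

/-- The width of a tree decomposition: the maximum bag size minus one. -/
def TreeDecomposition.width {G : SimpleGraph V} {ι : Type} [Fintype ι]
    (D : G.TreeDecomposition ι) : ℕ :=
  (Finset.univ.sup fun i => (D.bag i).card) - 1

/-- The treewidth of a (finite, nonempty) graph: the minimum width of a tree decomposition. -/
noncomputable def treewidth (G : SimpleGraph V) : ℕ :=
  sInf {w | ∃ (ι : Type) (_ : Fintype ι) (D : G.TreeDecomposition ι), D.width = w}

/-- `IsTwoTerminalSP S s t`: the subgraph `S` of `G` is a two-terminal series-parallel graph with
terminals `s` and `t`, i.e. it is obtained from single edges by series and parallel compositions. -/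
inductive IsTwoTerminalSP {G : SimpleGraph V} : G.Subgraph → V → V → Prop
  | edge {s t : V} (h : G.Adj s t) : IsTwoTerminalSP (G.subgraphOfAdj h) s t
  | series {S₁ S₂ : G.Subgraph} {s m t : V} :
      IsTwoTerminalSP S₁ s m → IsTwoTerminalSP S₂ m t → S₁.verts ∩ S₂.verts = {m} →
      IsTwoTerminalSP (S₁ ⊔ S₂) s t
  | parallel {S₁ S₂ : G.Subgraph} {s t : V} :
      IsTwoTerminalSP S₁ s t → IsTwoTerminalSP S₂ s t → S₁.verts ∩ S₂.verts = {s, t} →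
      IsTwoTerminalSP (S₁ ⊔ S₂) s t

/-- A graph is series-parallel if it is two-terminal series-parallel for some two terminals. -/
def IsSeriesParallel (G : SimpleGraph V) : Prop :=
  ∃ s t : V, IsTwoTerminalSP (⊤ : G.Subgraph) s t

end SimpleGraph

/-- Vertices of the pattern. `Sum.inl (s, i, l)` is the node with label `l` (the labels `0, 1, 2`
stand for the labels 1, 2, 3) of triangle number `i` on side `s` (side `0` is `A`, side `1` is `B`).
`Sum.inr (s, i, p)` is the inner node next to side `s` of the `p`-th path of length three
between the two triangles number `i`. -/
abbrev PatternVertex (k : ℕ) : Type :=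
  (Fin 2 × Fin 2 × Fin 3) ⊕ (Fin 2 × Fin 2 × Fin k)

/-- The pattern `H_k`: four triangles `A₁, A₂, B₁, B₂`; an edge between the nodes 1 of `A₁` and `A₂`
and one between the nodes 1 of `B₁` and `B₂`; and, for `i = 1, 2`, `k` internally disjoint paths of
length three between the node 2 of `A_i` and the node 2 of `B_i`. -/
def patternGraph (k : ℕ) : SimpleGraph (PatternVertex k) where
  Adj
    | .inl (s, i, l), .inl (s', i', l') =>
        s = s' ∧ ((i = i' ∧ l ≠ l') ∨ (i ≠ i' ∧ l = 0 ∧ l' = 0))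
    | .inl (s, i, l), .inr (s', i', _) => s = s' ∧ i = i' ∧ l = 1
    | .inr (s, i, _), .inl (s', i', l') => s = s' ∧ i = i' ∧ l' = 1
    | .inr (s, i, p), .inr (s', i', p') => s ≠ s' ∧ i = i' ∧ p = p'
  symm := ⟨by
    rintro (⟨s, i, l⟩ | ⟨s, i, p⟩) (⟨s', i', l'⟩ | ⟨s', i', p'⟩) h <;> simp only at h ⊢ <;> grind⟩
  loopless := ⟨by
    rintro (⟨s, i, l⟩ | ⟨s, i, p⟩) h <;> simp only at h <;> grind⟩

/-! ### Families of lower bound graphs -/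

/-- Set disjointness on `m` bits: the value is `false` iff the two inputs share a one. -/
def disj (m : ℕ) (x₀ x₁ : Fin m → Bool) : Bool :=
  decide (¬ ∃ i, x₀ i = true ∧ x₁ i = true)

/-- The graphs `G n x₀ x₁` on `n` nodes form a family of lower bound graphs for the graph predicate
`P` with respect to the functions `f n` on two `m n`-bit inputs, with cut size `C n`: for all large
`n`, `G n x₀ x₁` satisfies `P` iff `f n x₀ x₁ = 1`, and `G n x₀ x₁` is the union of a graph
on `V₀` that depends on `x₀` only, a graph on `V₁` that depends on `x₁` only, and a fixed set of
`C n` edges between `V₀` and `V₁`. -/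
def IsLowerBoundFamily (P : ∀ n : ℕ, SimpleGraph (Fin n) → Prop) (m C : ℕ → ℕ)
    (f : ∀ n : ℕ, (Fin (m n) → Bool) → (Fin (m n) → Bool) → Bool)
    (G : ∀ n : ℕ, (Fin (m n) → Bool) → (Fin (m n) → Bool) → SimpleGraph (Fin n)) : Prop :=
  ∃ n₀ : ℕ, ∀ n ≥ n₀,
    (∀ x₀ x₁, P n (G n x₀ x₁) ↔ f n x₀ x₁ = true) ∧
    ∃ (V₀ V₁ : Set (Fin n)) (E₀ E₁ : (Fin (m n) → Bool) → SimpleGraph (Fin n))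
      (S : SimpleGraph (Fin n)),
      Disjoint V₀ V₁ ∧ V₀ ∪ V₁ = Set.univ ∧
      (∀ x u v, (E₀ x).Adj u v → u ∈ V₀ ∧ v ∈ V₀) ∧
      (∀ x u v, (E₁ x).Adj u v → u ∈ V₁ ∧ v ∈ V₁) ∧
      (∀ u v, S.Adj u v → (u ∈ V₀ ∧ v ∈ V₁) ∨ (u ∈ V₁ ∧ v ∈ V₀)) ∧
      S.edgeSet.ncard = C n ∧
      ∀ x₀ x₁, G n x₀ x₁ = E₀ x₀ ⊔ E₁ x₁ ⊔ S

/-! ### The CONGEST model -/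

/-- A message of at most `B` bits. -/
abbrev Message (B : ℕ) : Type := {w : List Bool // w.length ≤ B}

/-- A deterministic algorithm in the CONGEST model with bandwidth `B` on `n`-node networks with node
identifiers `Fin n`. Initially a node knows its identifier and those of its neighbours (and `n` and
`B`). In each synchronous round it sends one message of at most `B` bits to each of its neighbours,
receives their messages, and updates its state. Local computation is unrestricted. -/
structure CongestAlgorithm (n B : ℕ) where
  State : Type
  init : Fin n → Set (Fin n) → State
  /-- `send q u` is what a node in state `q` sends to its neighbour `u`. -/
  send : State → Fin n → Message B
  /-- The received messages are indexed by the sender, `none` for a non-neighbour. -/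
  receive : State → (Fin n → Option (Message B)) → State
  output : State → Bool

namespace CongestAlgorithm

variable {n B : ℕ}

open Classical in
/-- The state of each node after `t` rounds on the network `G`. -/
noncomputable def run (A : CongestAlgorithm n B) (G : SimpleGraph (Fin n)) :
    ℕ → Fin n → A.State
  | 0, v => A.init v (G.neighborSet v)
  | t + 1, v => A.receive (A.run G t v) fun u =>
      if G.Adj u v then some (A.send (A.run G t u) v) else none

/-- After `T` rounds, some node reports that the network is a yes-instance. -/
def Accepts (A : CongestAlgorithm n B) (T : ℕ) (G : SimpleGraph (Fin n)) : Prop :=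
  ∃ v, A.output (A.run G T v) = true

end CongestAlgorithm

/-- Some deterministic CONGEST algorithm with bandwidth `B` decides `P` in `T` rounds on all
`n`-node networks: some node reports a yes-instance iff the network satisfies `P`. -/
def DeterministicallySolvable {n : ℕ} (P : SimpleGraph (Fin n) → Prop) (B T : ℕ) : Prop :=
  ∃ A : CongestAlgorithm n B, ∀ G : SimpleGraph (Fin n), A.Accepts T G ↔ P G

/-- Some randomized CONGEST algorithm with bandwidth `B` decides `P` in `T` rounds with probability
at least `2/3` on every `n`-node network. A point of `Ω` holds all random bits of all nodes; the
nodes may share them (independent private bits are the case where node `v` uses only its own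
coordinate of a product space). -/
def RandomizedSolvable {n : ℕ} (P : SimpleGraph (Fin n) → Prop) (B T : ℕ) : Prop :=
  ∃ (Ω : Type) (_ : MeasurableSpace Ω) (μ : Measure Ω) (_ : IsProbabilityMeasure μ)
    (A : Ω → CongestAlgorithm n B), ∀ G : SimpleGraph (Fin n),
      MeasurableSet {ω | (A ω).Accepts T G ↔ P G} ∧
      (2 / 3 : ℝ≥0∞) ≤ μ {ω | (A ω).Accepts T G ↔ P G}

/-- `H`-detection on `n`-node networks: does `G` contain a copy of `H`? -/
def HasCopy {W : Type*} (H : SimpleGraph W) (n : ℕ) (G : SimpleGraph (Fin n)) : Prop :=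
  H.IsContained G

/-- Induced `H`-detection on `n`-node networks: does `G` contain an induced copy of `H`? -/
def HasInducedCopy {W : Type*} (H : SimpleGraph W) (n : ℕ) (G : SimpleGraph (Fin n)) : Prop :=
  H.IsIndContained G

/-! The round bounds come from a reduction to set disjointness. On each of two sides, and for each
triangle number `i`, the host graph has one triangle per word of length `k` over `s` letters. The
node of label `1` in triangle `u` is joined to the letter nodes `(j, u j)`, and the cut matches
equal letter nodes of the two sides, so only `2 * k * s` cut edges serve `s ^ k` words. An input bit
belongs to a pair `(u, v)` of words and becomes an edge between the label `0` nodes of triangle `u`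
(number `0`) and triangle `v` (number `1`). A copy of the pattern must map triangles to triangles
and bridges to input edges, and its `k` disjoint paths force the linked triangles to agree in all
`k` letters. Hence a copy forces a pair present in both inputs, and such a pair yields an induced
copy (`hostGraph.exists_common_of_hom`, `hostGraph.nonempty_embedding`). With `s` of order `n ^ (1 /
k)` there are order `n ^ 2` bits and order `n ^ (1 / k)` cut edges.

A `T`-round algorithm becomes a protocol whose transcript is the traffic over the cut plus two
acceptance bits (`isRectangular_transcript`). Disjointness on `m` bits needs a transcript of order
`m` bits (`card_le_log_card_transcripts`). On random disjoint inputs, a function with few values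
barely feels a single coordinate on average, by the level-one inequality. The cut-and-paste property
of rectangles transfers this from one flipped bit to a planted intersection, so the protocol cannot
detect the latter.

For the structure of the pattern: a triangle always lies in one bag, by the median property of
trees, and an explicit decomposition has bags of size at most three. One bridge is parallel to the
series chain formed by the rest of the ring. -/

/-! ### Randomized communication complexity of set disjointness -/

section Disjointness

variable {ι : Type*} [Fintype ι] [DecidableEq ι]

/-- The sign `±1` of a bit. -/
noncomputable def bitSign (b : Bool) : ℝ := if b then 1 else -1

/-- The sum factors over coordinates into terms `2 * cosh (b j)`, and `cosh x ≤ exp (x ^ 2 / 2)`. -/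
theorem sum_exp_mul_bitSign (b : ι → ℝ) :
    ∑ z : ι → Bool, Real.exp (∑ j, b j * bitSign (z j)) ≤
      2 ^ Fintype.card ι * Real.exp ((∑ j, b j ^ 2) / 2) := by
  have h1 : ∑ z : ι → Bool, Real.exp (∑ j, b j * bitSign (z j)) =
      ∏ j, ∑ a : Bool, Real.exp (b j * bitSign a) := by
    rw [Finset.prod_univ_sum, Fintype.piFinset_univ]
    exact Finset.sum_congr rfl fun z _ => Real.exp_sum _ _
  rw [h1, Finset.sum_div, Real.exp_sum, ← Finset.card_univ, ← Finset.prod_const,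
    ← Finset.prod_mul_distrib]
  refine Finset.prod_le_prod (fun j _ => Finset.sum_nonneg fun a _ => (Real.exp_pos _).le)
    fun j _ => ?_
  have := Real.cosh_le_exp_half_sq (b j)
  rw [Real.cosh_eq] at this
  simp [bitSign]
  linarith

/-- The level-one inequality: the squared Fourier weight of a set on the first level. -/
theorem sum_sq_sum_bitSign_le (S : Finset (ι → Bool)) (hS : S.Nonempty) :
    ∑ j, (∑ z ∈ S, bitSign (z j)) ^ 2 ≤
      2 * (S.card : ℝ) ^ 2 * Real.log (2 ^ Fintype.card ι / S.card) := by
  have hs : (0 : ℝ) < S.card := by exact_mod_cast hS.card_pos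
  -- The mean sign vector of `S` is used as its own test direction: the average over `S` of its
  -- inner product with the sign vector of `z` is then `∑ j, b j ^ 2`. Jensen and the moment bound
  -- over the whole cube leave only half of this in the exponent.
  set b : ι → ℝ := fun j => (∑ z ∈ S, bitSign (z j)) / S.card with hb
  have hbs : ∑ j, b j ^ 2 = ∑ z ∈ S, (S.card : ℝ)⁻¹ • ∑ j, b j * bitSign (z j) := by
    simp only [smul_eq_mul, Finset.mul_sum]
    rw [Finset.sum_comm]
    refine Finset.sum_congr rfl fun j _ => ?_
    rw [← Finset.mul_sum, ← Finset.mul_sum, sq]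
    nth_rewrite 2 [hb]
    field_simp
  have hJ : Real.exp (∑ j, b j ^ 2) ≤
      ∑ z ∈ S, (S.card : ℝ)⁻¹ • Real.exp (∑ j, b j * bitSign (z j)) := by
    rw [hbs]
    refine convexOn_exp.map_sum_le (fun _ _ => by positivity) ?_ (fun _ _ => Set.mem_univ _)
    rw [Finset.sum_const, nsmul_eq_mul, mul_inv_cancel₀ hs.ne']
  have h2 : Real.exp (∑ j, b j ^ 2) ≤
      2 ^ Fintype.card ι / S.card * Real.exp ((∑ j, b j ^ 2) / 2) := by
    refine hJ.trans ?_
    simp only [smul_eq_mul]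
    rw [← Finset.mul_sum, div_mul_eq_mul_div, inv_mul_eq_div]
    refine div_le_div_of_nonneg_right ?_ hs.le
    refine le_trans ?_ (sum_exp_mul_bitSign b)
    exact Finset.sum_le_sum_of_subset_of_nonneg (Finset.subset_univ _)
      fun _ _ _ => (Real.exp_pos _).le
  have h3 : (∑ j, b j ^ 2) / 2 ≤ Real.log (2 ^ Fintype.card ι / S.card) := by
    rw [Real.le_log_iff_exp_le (by positivity)]
    have : Real.exp (∑ j, b j ^ 2) =
        Real.exp ((∑ j, b j ^ 2) / 2) * Real.exp ((∑ j, b j ^ 2) / 2) := by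
      rw [← Real.exp_add]; ring_nf
    rw [this] at h2
    exact le_of_mul_le_mul_right h2 (Real.exp_pos _)
  have h4 : ∑ j, (∑ z ∈ S, bitSign (z j)) ^ 2 = (S.card : ℝ) ^ 2 * ∑ j, b j ^ 2 := by
    rw [Finset.mul_sum]
    refine Finset.sum_congr rfl fun j _ => ?_
    rw [hb]; field_simp
  rw [h4]
  nlinarith [mul_le_mul_of_nonneg_left h3 (sq_nonneg (S.card : ℝ))]

/-- Every `z` with `z j = b` is reached from exactly two points, itself and its flip at `j`. -/
theorem sum_update_eq (g : (ι → Bool) → ℝ) (j : ι) (b : Bool) :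
    ∑ z, g (Function.update z j b) = 2 * ∑ z, if z j = b then g z else 0 := by
  have hflip : Function.Involutive fun z : ι → Bool => Function.update z j (!z j) := by
    intro z; simp
  have h := Equiv.sum_comp (hflip.toPerm _) fun z => if z j = b then g z else 0
  rw [two_mul]
  nth_rewrite 1 [← h]
  rw [← Finset.sum_add_distrib]
  refine Finset.sum_congr rfl fun z _ => ?_
  have h0 : hflip.toPerm _ z = Function.update z j (!z j) := rfl
  rw [h0]
  by_cases hz : z j = b
  · have : Function.update z j b = z := by rw [← hz]; exact Function.update_eq_self _ _
    simp [hz, this]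
  · have : (!z j) = b := by revert hz; cases z j <;> cases b <;> simp
    simp [hz, this]

/-! ### Hellinger distance and cut-and-paste for rectangular transcripts -/

variable {τ : Type*} [DecidableEq τ]

theorem sq_sqrt_sub_sqrt_le {a b s : ℝ} (ha : 0 ≤ a) (hb : 0 ≤ b) (hs : 0 < s)
    (h : a + b = s) : (√a - √b) ^ 2 ≤ (a - b) ^ 2 / s := by
  rw [le_div_iff₀ hs]
  have h1 : (a - b) ^ 2 = (√a - √b) ^ 2 * (√a + √b) ^ 2 := by
    rw [← mul_pow]; congr 1
    nlinarith [Real.sq_sqrt ha, Real.sq_sqrt hb]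
  rw [h1]
  refine mul_le_mul_of_nonneg_left ?_ (sq_nonneg _)
  nlinarith [Real.sq_sqrt ha, Real.sq_sqrt hb, mul_nonneg (Real.sqrt_nonneg a) (Real.sqrt_nonneg b)]

/-- The number of assignments `z` for which `g z` has the value `t`. -/
noncomputable def hits {α : Type*} [Fintype α] (g : α → τ) (t : τ) : ℝ :=
  ∑ z, if g z = t then 1 else 0

theorem hits_nonneg {α : Type*} [Fintype α] (g : α → τ) (t : τ) : 0 ≤ hits g t :=
  Finset.sum_nonneg fun _ _ => by split_ifs <;> norm_num

theorem sum_hits {α : Type*} [Fintype α] [Fintype τ] (g : α → τ) : ∑ t, hits g t = Fintype.card α := by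
  simp only [hits]
  rw [Finset.sum_comm]
  simp

/-- The value of a function with few values depends little on most bits of its argument. -/
theorem sum_hellinger_le [Fintype τ] (f : (ι → Bool) → τ) :
    ∑ j, ∑ t, (√(hits (fun z => f (Function.update z j true)) t) -
        √(hits (fun z => f (Function.update z j false)) t)) ^ 2 ≤
      4 * (2 ^ Fintype.card ι * Real.log (Fintype.card τ)) := by
  set N : ℝ := 2 ^ Fintype.card ι with hN
  have hNpos : 0 < N := by positivity
  have hM : (0 : ℝ) < Fintype.card τ := by
    have : Nonempty τ := ⟨f fun _ => false⟩
    exact_mod_cast Fintype.card_pos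
  set M : ℝ := (Fintype.card τ : ℝ) with hMdef
  rw [Finset.sum_comm]
  -- The bound is linear in `hits f t` apart from a constant, so summing over `t` is immediate: `N /
  -- M` and `hits f t` both sum to `N` and cancel.
  have key : ∀ t : τ, ∑ j, (√(hits (fun z => f (Function.update z j true)) t) -
        √(hits (fun z => f (Function.update z j false)) t)) ^ 2 ≤
      4 * (N / M - hits f t + hits f t * Real.log M) := by
    intro t
    set S : Finset (ι → Bool) := Finset.univ.filter fun z => f z = t with hSdef
    have hSc : hits f t = S.card := by simp [hits, hSdef]
    have hadd : ∀ j, hits (fun z => f (Function.update z j true)) t +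
        hits (fun z => f (Function.update z j false)) t = 2 * S.card := by
      intro j
      simp only [hits]
      rw [sum_update_eq (fun z => if f z = t then (1 : ℝ) else 0) j true,
        sum_update_eq (fun z => if f z = t then (1 : ℝ) else 0) j false, ← mul_add,
        ← Finset.sum_add_distrib, ← hSc, hits]
      congr 1
      refine Finset.sum_congr rfl fun z _ => ?_
      cases z j <;> simp
    have hsub : ∀ j, hits (fun z => f (Function.update z j true)) t -
        hits (fun z => f (Function.update z j false)) t = 2 * ∑ z ∈ S, bitSign (z j) := by
      intro j
      simp only [hits]
      rw [sum_update_eq (fun z => if f z = t then (1 : ℝ) else 0) j true,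
        sum_update_eq (fun z => if f z = t then (1 : ℝ) else 0) j false, ← mul_sub,
        ← Finset.sum_sub_distrib, hSdef, Finset.sum_filter]
      congr 1
      refine Finset.sum_congr rfl fun z _ => ?_
      by_cases h : f z = t <;> cases z j <;> simp [bitSign, h]
    rcases S.eq_empty_or_nonempty with hS | hS
    · have h0 : ∀ j, hits (fun z => f (Function.update z j true)) t = 0 ∧
          hits (fun z => f (Function.update z j false)) t = 0 := by
        intro j
        have h1 := hadd j
        have h2 := hsub j
        simp only [hS, Finset.card_empty, Finset.sum_empty] at h1 h2
        constructor <;> push_cast at * <;> linarith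
      simp only [h0, hSc, hS]
      simp
      positivity
    · have hs : (0 : ℝ) < S.card := by exact_mod_cast hS.card_pos
      have h1 : ∑ j, (√(hits (fun z => f (Function.update z j true)) t) -
          √(hits (fun z => f (Function.update z j false)) t)) ^ 2 ≤
          ∑ j, (∑ z ∈ S, bitSign (z j)) ^ 2 * (2 / S.card) := by
        refine Finset.sum_le_sum fun j _ => ?_
        refine (sq_sqrt_sub_sqrt_le (hits_nonneg _ _) (hits_nonneg _ _)
          (by positivity) (hadd j)).trans (le_of_eq ?_)
        rw [hsub j]; field_simp
      refine h1.trans ?_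
      rw [← Finset.sum_mul]
      refine (mul_le_mul_of_nonneg_right (sum_sq_sum_bitSign_le S hS) (by positivity)).trans ?_
      rw [hSc]
      -- Since `log x ≤ x - 1` at `x = N / (|S| * M)`; this replaces the bound of entropy by the log
      -- of the number of values.
      have hlog : Real.log (N / S.card) ≤ N / (S.card * M) - 1 + Real.log M := by
        have : N / S.card = N / (S.card * M) * M := by field_simp
        rw [this, Real.log_mul (by positivity) hM.ne']
        linarith [Real.log_le_sub_one_of_pos (show 0 < N / (S.card * M) by positivity)]
      calc 2 * (S.card : ℝ) ^ 2 * Real.log (N / S.card) * (2 / S.card)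
          = 4 * (S.card * Real.log (N / S.card)) := by field_simp; ring
        _ ≤ 4 * (S.card * (N / (S.card * M) - 1 + Real.log M)) := by gcongr
        _ = _ := by field_simp
  refine (Finset.sum_le_sum fun t _ => key t).trans (le_of_eq ?_)
  rw [← Finset.mul_sum, Finset.sum_add_distrib, Finset.sum_sub_distrib, ← Finset.sum_mul, sum_hits,
    Finset.sum_const, Finset.card_univ, nsmul_eq_mul]
  have : M * (N / M) = N := by field_simp
  rw [this]
  simp [hN]

/-- Alice's input for the selector `d` and the random bits `z`. -/
def aliceBits (d z : ι → Bool) : ι → Bool := fun i => d i && z i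

/-- Bob's input for the selector `d` and the random bits `z`. -/
def bobBits (d z : ι → Bool) : ι → Bool := fun i => !d i && z i

/-- The map `F` from pairs of inputs to transcripts partitions the inputs into rectangles. -/
def IsRectangular {X Y : Type*} (F : X → Y → τ) : Prop :=
  ∀ x y x' y', F x y = F x' y' → F x y' = F x y

/-- The transcript on the input for `d` and `z` with coordinate `j` set to `a` and `b`. -/
def plant (F : (ι → Bool) → (ι → Bool) → τ) (j : ι) (a b : Bool) (d z : ι → Bool) : τ :=
  F (Function.update (aliceBits d z) j a) (Function.update (bobBits d z) j b)

/-- Cut and paste. For fixed `d`, Alice's input reads `z` only where `d` is true and Bob's only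
where it is false. Exchanging these parts between two samples `z` and `w` is a bijection that swaps
Bob's inputs, and a rectangle is closed under that swap. -/
theorem hits_plant_mul (F : (ι → Bool) → (ι → Bool) → τ) (hF : IsRectangular F) (j : ι)
    (d : ι → Bool) (t : τ) :
    hits (plant F j false false d) t * hits (plant F j true true d) t =
      hits (plant F j false true d) t * hits (plant F j true false d) t := by
  simp only [hits]
  rw [Fintype.sum_mul_sum, Fintype.sum_mul_sum, ← Fintype.sum_prod_type', ← Fintype.sum_prod_type']
  have hinv : Function.Involutive fun p : (ι → Bool) × (ι → Bool) =>
      ((fun i => if d i then p.1 i else p.2 i, fun i => if d i then p.2 i else p.1 i) :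
        (ι → Bool) × (ι → Bool)) := by
    rintro ⟨z, w⟩
    ext i <;> by_cases h : d i <;> simp [h]
  rw [← Equiv.sum_comp (hinv.toPerm _)]
  refine Finset.sum_congr rfl fun p _ => ?_
  obtain ⟨z, w⟩ := p
  have h0 : hinv.toPerm _ (z, w) = ((fun i => if d i then z i else w i,
    fun i => if d i then w i else z i) : (ι → Bool) × (ι → Bool)) := rfl
  rw [h0]
  have e1 : aliceBits d (fun i => if d i then z i else w i) = aliceBits d z := by
    ext i; by_cases h : d i <;> simp [aliceBits, h]
  have e2 : aliceBits d (fun i => if d i then w i else z i) = aliceBits d w := by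
    ext i; by_cases h : d i <;> simp [aliceBits, h]
  have e3 : bobBits d (fun i => if d i then z i else w i) = bobBits d w := by
    ext i; by_cases h : d i <;> simp [bobBits, h]
  have e4 : bobBits d (fun i => if d i then w i else z i) = bobBits d z := by
    ext i; by_cases h : d i <;> simp [bobBits, h]
  set x := Function.update (aliceBits d z) j false
  set y := Function.update (bobBits d z) j true
  set x' := Function.update (aliceBits d w) j true
  set y' := Function.update (bobBits d w) j false
  have hiff : (F x y' = t ∧ F x' y = t) ↔ (F x y = t ∧ F x' y' = t) := by
    constructor
    · rintro ⟨h1, h2⟩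
      exact ⟨(hF x y' x' y (h1.trans h2.symm)).trans h1,
        (hF x' y x y' (h2.trans h1.symm)).trans h2⟩
    · rintro ⟨h1, h2⟩
      exact ⟨(hF x y x' y' (h1.trans h2.symm)).trans h1,
        (hF x' y' x y (h2.trans h1.symm)).trans h2⟩
  have p1 : plant F j false false d (fun i => if d i then z i else w i) = F x y' := by
    simp only [plant, e1, e3, x, y']
  have p2 : plant F j true true d (fun i => if d i then w i else z i) = F x' y := by
    simp only [plant, e2, e4, x', y]
  rw [p1, p2, show plant F j false true d z = F x y from rfl,
    show plant F j true false d w = F x' y' from rfl]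
  rw [ite_zero_mul_ite_zero, ite_zero_mul_ite_zero]
  simp only [hiff]

/-- The (unnormalized) squared Hellinger distance of two functions. -/
noncomputable def hellinger [Fintype τ] (p q : τ → ℝ) : ℝ := ∑ t, (√(p t) - √(q t)) ^ 2

/-- The squared distance is the total mass minus `2 * ∑ √(p t * q t)`. The masses are all equal, and
cut and paste equates the products. -/
theorem hellinger_plant_eq [Fintype τ] (F : (ι → Bool) → (ι → Bool) → τ) (hF : IsRectangular F)
    (j : ι) (d : ι → Bool) :
    hellinger (hits (plant F j false false d)) (hits (plant F j true true d)) =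
      hellinger (hits (plant F j false true d)) (hits (plant F j true false d)) := by
  have h : ∀ p q : τ → ℝ, (∀ t, 0 ≤ p t) → (∀ t, 0 ≤ q t) →
      hellinger p q = ∑ t, p t + ∑ t, q t - 2 * ∑ t, √(p t * q t) := by
    intro p q hp hq
    rw [hellinger, Finset.mul_sum, ← Finset.sum_add_distrib, ← Finset.sum_sub_distrib]
    refine Finset.sum_congr rfl fun t _ => ?_
    rw [Real.sqrt_mul (hp t)]
    nlinarith [Real.sq_sqrt (hp t), Real.sq_sqrt (hq t)]
  rw [h _ _ (hits_nonneg _) (hits_nonneg _), h _ _ (hits_nonneg _) (hits_nonneg _)]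
  simp only [hits_plant_mul F hF, sum_hits]

theorem hellinger_plant_le [Fintype τ] (F : (ι → Bool) → (ι → Bool) → τ) (hF : IsRectangular F)
    (j : ι) (d : ι → Bool) :
    hellinger (hits (plant F j false false d)) (hits (plant F j true true d)) ≤
      2 * (hellinger (hits (plant F j true false d)) (hits (plant F j false false d)) +
        hellinger (hits (plant F j false true d)) (hits (plant F j false false d))) := by
  rw [hellinger_plant_eq F hF]
  simp only [hellinger]
  rw [← Finset.sum_add_distrib, Finset.mul_sum]
  refine Finset.sum_le_sum fun t _ => ?_
  set a := √(hits (plant F j false true d) t)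
  set b := √(hits (plant F j true false d) t)
  set c := √(hits (plant F j false false d) t)
  nlinarith [sq_nonneg (a + b - 2 * c)]

set_option linter.unusedSectionVars false in
theorem plant_update (F : (ι → Bool) → (ι → Bool) → τ) (j : ι) (a b c : Bool) (d : ι → Bool) :
    plant F j a b (Function.update d j c) = plant F j a b d := by
  funext z
  have h1 : Function.update (aliceBits (Function.update d j c) z) j a =
      Function.update (aliceBits d z) j a := by
    ext i; by_cases h : i = j
    · subst h; simp
    · simp [aliceBits, h]
  have h2 : Function.update (bobBits (Function.update d j c) z) j b =
      Function.update (bobBits d z) j b := by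
    ext i; by_cases h : i = j
    · subst h; simp
    · simp [bobBits, h]
  simp only [plant, h1, h2]

set_option linter.unusedSectionVars false in
-- Bit `j` of `z` reaches only the party selected by `d j`, so flipping it keeps the inputs disjoint
-- and changes one player's bit.
theorem eval_update_eq_plant (F : (ι → Bool) → (ι → Bool) → τ) (j : ι) (b : Bool)
    (d z : ι → Bool) :
    F (aliceBits d (Function.update z j b)) (bobBits d (Function.update z j b)) =
      plant F j (d j && b) (!d j && b) d z := by
  have h1 : aliceBits d (Function.update z j b) =
      Function.update (aliceBits d z) j (d j && b) := by
    ext i; by_cases h : i = j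
    · subst h; simp [aliceBits]
    · simp [aliceBits, h]
  have h2 : bobBits d (Function.update z j b) = Function.update (bobBits d z) j (!d j && b) := by
    ext i; by_cases h : i = j
    · subst h; simp [bobBits]
    · simp [bobBits, h]
  simp only [plant, h1, h2]

theorem sum_hellinger_plant_le [Fintype τ] (F : (ι → Bool) → (ι → Bool) → τ)
    (hF : IsRectangular F) :
    ∑ j, ∑ d, hellinger (hits (plant F j false false d)) (hits (plant F j true true d)) ≤
      16 * ((2 ^ Fintype.card ι) ^ 2 * Real.log (Fintype.card τ)) := by
  have h1 : ∀ j, ∑ d, hellinger (hits (plant F j false false d)) (hits (plant F j true true d)) ≤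
      4 * ∑ d : ι → Bool, ∑ t,
        (√(hits (fun z => F (aliceBits d (Function.update z j true))
            (bobBits d (Function.update z j true))) t) -
          √(hits (fun z => F (aliceBits d (Function.update z j false))
            (bobBits d (Function.update z j false))) t)) ^ 2 := by
    intro j
    -- The planted terms ignore `d j`, so each sum over all `d` is twice the sum over those `d`
    -- whose selector lets that player own bit `j`. Together with the factor from
    -- `hellinger_plant_le` this gives the `4`.
    have e1 := sum_update_eq (fun d =>
      hellinger (hits (plant F j true false d)) (hits (plant F j false false d))) j true
    have e2 := sum_update_eq (fun d =>
      hellinger (hits (plant F j false true d)) (hits (plant F j false false d))) j false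
    simp only [plant_update] at e1 e2
    calc _ ≤ ∑ d, 2 * (hellinger (hits (plant F j true false d)) (hits (plant F j false false d)) +
          hellinger (hits (plant F j false true d)) (hits (plant F j false false d))) :=
          Finset.sum_le_sum fun d _ => hellinger_plant_le F hF j d
      _ = 4 * ∑ d : ι → Bool,
          ((if d j = true then
              hellinger (hits (plant F j true false d)) (hits (plant F j false false d)) else 0) +
            (if d j = false then
              hellinger (hits (plant F j false true d)) (hits (plant F j false false d)) else 0)) := by
          rw [← Finset.mul_sum, Finset.sum_add_distrib, Finset.sum_add_distrib, e1, e2]; ring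
      _ = _ := by
          congr 1
          refine Finset.sum_congr rfl fun d _ => ?_
          simp only [eval_update_eq_plant]
          cases h : d j <;> simp [hellinger]
  refine (Finset.sum_le_sum fun j _ => h1 j).trans ?_
  rw [← Finset.mul_sum, Finset.sum_comm]
  have h2 := Finset.sum_le_sum fun (d : ι → Bool) (_ : d ∈ Finset.univ) =>
    sum_hellinger_le fun z => F (aliceBits d z) (bobBits d z)
  rw [Finset.sum_const, Finset.card_univ, Fintype.card_fun, Fintype.card_bool, nsmul_eq_mul] at h2
  push_cast at h2
  nlinarith [h2]

theorem sum_indicator_eq {α : Type*} [Fintype α] [Fintype τ] (g : α → τ) (O : τ → Prop)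
    [DecidablePred O] :
    (∑ z, if O (g z) then (1 : ℝ) else 0) = ∑ t, if O t then hits g t else 0 := by
  have h : ∀ t, (if O t then hits g t else 0) =
      ∑ z, if g z = t then (if O t then (1 : ℝ) else 0) else 0 := by
    intro t
    by_cases ht : O t <;> simp [ht, hits]
  simp only [h]
  rw [Finset.sum_comm]
  simp

/-- A protocol with few transcripts hardly distinguishes the planted disjoint inputs from the
planted intersecting ones. -/
theorem sum_advantage_le [Fintype τ] (F : (ι → Bool) → (ι → Bool) → τ) (hF : IsRectangular F)
    (O : τ → Prop) [DecidablePred O] :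
    ∑ j, ∑ d, ∑ z, ((if O (plant F j false false d z) then (1 : ℝ) else 0) -
        (if O (plant F j true true d z) then 1 else 0)) ≤
      (2 ^ Fintype.card ι) ^ 2 * (96 * Real.log (Fintype.card τ) + Fintype.card ι / 6) := by
  have h1 : ∀ j d, ∑ z, ((if O (plant F j false false d z) then (1 : ℝ) else 0) -
        (if O (plant F j true true d z) then 1 else 0)) ≤
      6 * hellinger (hits (plant F j false false d)) (hits (plant F j true true d)) +
        2 ^ Fintype.card ι / 6 := by
    intro j d
    rw [Finset.sum_sub_distrib, sum_indicator_eq (plant F j false false d),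
      sum_indicator_eq (plant F j true true d), ← Finset.sum_sub_distrib]
    have h2 : (2 : ℝ) ^ Fintype.card ι / 6 = ∑ t, (hits (plant F j false false d) t +
        hits (plant F j true true d) t) / 12 := by
      rw [← Finset.sum_div, Finset.sum_add_distrib, sum_hits, sum_hits]
      simp; ring
    rw [h2, hellinger, Finset.mul_sum, ← Finset.sum_add_distrib]
    refine Finset.sum_le_sum fun t _ => ?_
    have ha := hits_nonneg (plant F j false false d) t
    have hb := hits_nonneg (plant F j true true d) t
    set a := hits (plant F j false false d) t
    set b := hits (plant F j true true d) t
    split_ifs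
    -- With `p = √a - √b` and `q = √a + √b`, the square `(12 * p - q) ^ 2 ≥ 0` gives `a - b = p * q
    -- ≤ 6 * p ^ 2 + q ^ 2 / 24`, and `q ^ 2 ≤ 2 * (a + b)`.
    · nlinarith [Real.sq_sqrt ha, Real.sq_sqrt hb, sq_nonneg (√a - √b),
        sq_nonneg (√a + √b), sq_nonneg (12 * (√a - √b) - (√a + √b))]
    · nlinarith [sq_nonneg (√a - √b)]
  refine (Finset.sum_le_sum fun j _ => Finset.sum_le_sum fun d _ => h1 j d).trans ?_
  simp only [Finset.sum_add_distrib, ← Finset.mul_sum]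
  have h3 := sum_hellinger_plant_le F hF
  simp only [Finset.sum_const, Finset.card_univ, Fintype.card_fun, Fintype.card_bool, nsmul_eq_mul]
  push_cast
  nlinarith [h3]

/-- The randomized communication lower bound for set disjointness: public-coin protocols with
transcripts in `τ` that err with probability at most `1/3` need exponentially many transcripts. -/
theorem card_le_log_card_transcripts [Fintype τ] {Ω : Type*} [MeasurableSpace Ω] (μ : Measure Ω)
    [IsProbabilityMeasure μ] (A : Ω → (ι → Bool) → (ι → Bool) → Prop)
    (hA : ∀ ω, ∃ (F : (ι → Bool) → (ι → Bool) → τ) (O : τ → Prop), IsRectangular F ∧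
      ∀ x y, A ω x y ↔ O (F x y))
    (hmeas : ∀ x y, MeasurableSet {ω | A ω x y ↔ ∃ i, x i = true ∧ y i = true})
    (hprob : ∀ x y, (2 / 3 : ℝ≥0∞) ≤ μ {ω | A ω x y ↔ ∃ i, x i = true ∧ y i = true}) :
    (Fintype.card ι : ℝ) ≤ 576 * Real.log (Fintype.card τ) := by
  classical
  set good : (ι → Bool) → (ι → Bool) → Set Ω :=
    fun x y => {ω | A ω x y ↔ ∃ i, x i = true ∧ y i = true} with hgood
  set N : ℝ := 2 ^ Fintype.card ι with hN
  have hNpos : 0 < N := by positivity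
  set ind : (ι → Bool) → (ι → Bool) → Ω → ℝ := fun x y => (good x y).indicator 1 with hind
  have hint : ∀ x y, Integrable (ind x y) μ := fun x y =>
    (integrable_const (1 : ℝ)).indicator (hmeas x y)
  have hval : ∀ x y, (2 / 3 : ℝ) ≤ ∫ ω, ind x y ω ∂μ := by
    intro x y
    rw [hind]
    simp only
    rw [integral_indicator_one (hmeas x y), Measure.real]
    have h := ENNReal.toReal_mono (measure_ne_top μ _) (hprob x y)
    simpa using h
  let X : ι → Bool → (ι → Bool) → (ι → Bool) → ι → Bool :=
    fun j a d z => Function.update (aliceBits d z) j a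
  let Y : ι → Bool → (ι → Bool) → (ι → Bool) → ι → Bool :=
    fun j a d z => Function.update (bobBits d z) j a
  let g : ι → (ι → Bool) → (ι → Bool) → Ω → ℝ := fun j d z ω =>
    ind (X j false d z) (Y j false d z) ω + ind (X j true d z) (Y j true d z) ω
  have hg : ∀ j d z, Integrable (g j d z) μ := fun j d z => (hint _ _).add (hint _ _)
  set f : Ω → ℝ := fun ω => ∑ j, ∑ d, ∑ z, g j d z ω with hf
  -- Being right with probability `2 / 3` on both planted inputs gives an expected score of `4 / 3`
  -- per triple. A fixed protocol scores `1` plus its advantage, so the excess `1 / 3` meets the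
  -- loss `1 / 6`, and `96 * 6 = 576`.
  have hlow : Fintype.card ι * N ^ 2 * (4 / 3) ≤ ∫ ω, f ω ∂μ := by
    have e : ∫ ω, f ω ∂μ = ∑ j, ∑ d, ∑ z, ((∫ ω, ind (X j false d z) (Y j false d z) ω ∂μ) +
        ∫ ω, ind (X j true d z) (Y j true d z) ω ∂μ) := by
      rw [hf, integral_finsetSum _ fun j _ => integrable_finsetSum _ fun d _ =>
        integrable_finsetSum _ fun z _ => hg j d z]
      refine Finset.sum_congr rfl fun j _ => ?_
      rw [integral_finsetSum _ fun d _ => integrable_finsetSum _ fun z _ => hg j d z]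
      refine Finset.sum_congr rfl fun d _ => ?_
      rw [integral_finsetSum _ fun z _ => hg j d z]
      exact Finset.sum_congr rfl fun z _ => integral_add (hint _ _) (hint _ _)
    rw [e]
    calc (Fintype.card ι : ℝ) * N ^ 2 * (4 / 3)
        = ∑ j : ι, ∑ d : ι → Bool, ∑ z : ι → Bool, (2 / 3 + 2 / 3 : ℝ) := by
          simp only [Finset.sum_const, Finset.card_univ, Fintype.card_fun, Fintype.card_bool,
            nsmul_eq_mul, hN]
          push_cast; ring
      _ ≤ _ := Finset.sum_le_sum fun j _ => Finset.sum_le_sum fun d _ =>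
          Finset.sum_le_sum fun z _ => add_le_add (hval _ _) (hval _ _)
  have hup : ∀ ω, f ω ≤ Fintype.card ι * N ^ 2 +
      N ^ 2 * (96 * Real.log (Fintype.card τ) + Fintype.card ι / 6) := by
    intro ω
    obtain ⟨F, O, hF, hO⟩ := hA ω
    -- The answer on planted disjoint inputs should be no, hence the negated event.
    have hadv := sum_advantage_le F hF fun t => ¬ O t
    have e : (Fintype.card ι : ℝ) * N ^ 2 = ∑ j : ι, ∑ d : ι → Bool, ∑ z : ι → Bool, (1 : ℝ) := by
      simp only [Finset.sum_const, Finset.card_univ, Fintype.card_fun, Fintype.card_bool,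
        nsmul_eq_mul, hN]
      push_cast; ring
    rw [e]
    refine le_trans (le_of_eq ?_) (add_le_add_right hadv _)
    simp only [← Finset.sum_add_distrib]
    refine Finset.sum_congr rfl fun j _ => Finset.sum_congr rfl fun d _ =>
      Finset.sum_congr rfl fun z _ => ?_
    have g0 : ind (X j false d z) (Y j false d z) ω =
        if ¬ O (plant F j false false d z) then 1 else 0 := by
      have hno : ¬ ∃ i, X j false d z i = true ∧ Y j false d z i = true := by
        rintro ⟨i, h1, h2⟩
        by_cases h : i = j
        · subst h; simp [X] at h1
        · simp [X, Y, h, aliceBits, bobBits] at h1 h2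
          simp [h1.1] at h2
      simp only [hind, Set.indicator, hgood, Set.mem_ofPred_eq, hno, iff_false, hO]
      rfl
    have g1 : ind (X j true d z) (Y j true d z) ω =
        if O (plant F j true true d z) then 1 else 0 := by
      have hyes : ∃ i, X j true d z i = true ∧ Y j true d z i = true := ⟨j, by simp [X, Y]⟩
      simp only [hind, Set.indicator, hgood, Set.mem_ofPred_eq, hyes, iff_true, hO]
      rfl
    simp only [g, g0, g1]
    split_ifs <;> norm_num
  have hle : ∫ ω, f ω ∂μ ≤ Fintype.card ι * N ^ 2 +
      N ^ 2 * (96 * Real.log (Fintype.card τ) + Fintype.card ι / 6) := by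
    have h := integral_mono (μ := μ) (f := f) (integrable_finsetSum _ fun j _ =>
      integrable_finsetSum _ fun d _ => integrable_finsetSum _ fun z _ => hg j d z) (integrable_const _) hup
    simpa using h
  have h := hlow.trans hle
  have h' : N ^ 2 * (Fintype.card ι : ℝ) ≤ N ^ 2 * (576 * Real.log (Fintype.card τ)) := by
    linarith
  exact le_of_mul_le_mul_left h' (by positivity)

end Disjointness

/-! ### Two-party simulation of CONGEST algorithms -/

/-- A message of at most `B` bits as a string of exactly `B` symbols. -/
def Message.encode {B : ℕ} (w : Message B) : Fin B → Option Bool := fun i => w.1[(i : ℕ)]?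

theorem Message.encode_injective {B : ℕ} :
    Function.Injective (Message.encode : Message B → Fin B → Option Bool) := by
  rintro ⟨w, hw⟩ ⟨w', hw'⟩ h
  refine Subtype.ext (List.ext_getElem? fun i => ?_)
  by_cases hi : i < B
  · exact congrFun h ⟨i, hi⟩
  · rw [List.getElem?_eq_none (hw.trans (by omega)), List.getElem?_eq_none (hw'.trans (by omega))]

/-- A vertex partition of a family of graphs given by two inputs, one for each side, with a fixed
cut `S`. -/
structure IsCutFamily {W X : Type*} (V₀ V₁ : Set W) (E₀ E₁ : X → SimpleGraph W)
    (S : SimpleGraph W) : Prop where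
  disjoint : Disjoint V₀ V₁
  cover : V₀ ∪ V₁ = Set.univ
  left : ∀ x u v, (E₀ x).Adj u v → u ∈ V₀ ∧ v ∈ V₀
  right : ∀ x u v, (E₁ x).Adj u v → u ∈ V₁ ∧ v ∈ V₁
  cut : ∀ u v, S.Adj u v → (u ∈ V₀ ∧ v ∈ V₁) ∨ (u ∈ V₁ ∧ v ∈ V₀)

namespace IsCutFamily

variable {W X : Type*} {V₀ V₁ : Set W} {E₀ E₁ : X → SimpleGraph W} {S : SimpleGraph W}

theorem not_mem_right (h : IsCutFamily V₀ V₁ E₀ E₁ S) {v : W} (hv : v ∈ V₀) : v ∉ V₁ :=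
  Set.disjoint_left.mp h.disjoint hv

theorem mem_or (h : IsCutFamily V₀ V₁ E₀ E₁ S) (v : W) : v ∈ V₀ ∨ v ∈ V₁ := by
  have : v ∈ V₀ ∪ V₁ := by rw [h.cover]; trivial
  exact this

theorem swap (h : IsCutFamily V₀ V₁ E₀ E₁ S) : IsCutFamily V₁ V₀ E₁ E₀ S :=
  ⟨h.disjoint.symm, by rw [Set.union_comm]; exact h.cover, h.right, h.left,
    fun u v huv => (h.cut u v huv).symm⟩

theorem adj_congr (h : IsCutFamily V₀ V₁ E₀ E₁ S) (x y y' : X) {u v : W} (hv : v ∈ V₀) :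
    (E₀ x ⊔ E₁ y' ⊔ S).Adj u v ↔ (E₀ x ⊔ E₁ y ⊔ S).Adj u v := by
  have h1 : ∀ y, ¬ (E₁ y).Adj u v := fun y hy => h.not_mem_right hv (h.right y u v hy).2
  simp [h1]

theorem cut_of_adj (h : IsCutFamily V₀ V₁ E₀ E₁ S) (x y : X) {u v : W} (hu : u ∈ V₁)
    (hv : v ∈ V₀) (huv : (E₀ x ⊔ E₁ y ⊔ S).Adj u v) : S.Adj u v := by
  rcases huv with (h1 | h1) | h1
  · exact absurd hu (h.not_mem_right (h.left _ _ _ h1).1)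
  · exact absurd (h.right _ _ _ h1).2 (h.not_mem_right hv)
  · exact h1

end IsCutFamily

namespace CongestAlgorithm

variable {n B : ℕ} {X : Type*} {V₀ V₁ : Set (Fin n)} {E₀ E₁ : X → SimpleGraph (Fin n)}
  {S : SimpleGraph (Fin n)}

theorem run_succ_congr (A : CongestAlgorithm n B) {G G' : SimpleGraph (Fin n)} {t : ℕ} {v : Fin n}
    (hv : A.run G t v = A.run G' t v) (hadj : ∀ u, G.Adj u v ↔ G'.Adj u v)
    (hsend : ∀ u, G'.Adj u v → A.send (A.run G t u) v = A.send (A.run G' t u) v) :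
    A.run G (t + 1) v = A.run G' (t + 1) v := by
  simp only [run, hv]
  congr 1
  funext u
  by_cases h : G'.Adj u v
  · rw [if_pos ((hadj u).2 h), if_pos h, hsend u h]
  · rw [if_neg (fun h' => h ((hadj u).1 h')), if_neg h]

/-- If two runs exchange the same messages over the cut, then either side behaves in the mixed
graph as it does in its own graph. -/
theorem run_mixed (h : IsCutFamily V₀ V₁ E₀ E₁ S) (A : CongestAlgorithm n B) (T : ℕ)
    (x y x' y' : X)
    (hmsg : ∀ t < T, ∀ u v, S.Adj u v → A.send (A.run (E₀ x ⊔ E₁ y ⊔ S) t u) v =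
      A.send (A.run (E₀ x' ⊔ E₁ y' ⊔ S) t u) v) :
    ∀ t ≤ T, (∀ v ∈ V₀, A.run (E₀ x ⊔ E₁ y' ⊔ S) t v = A.run (E₀ x ⊔ E₁ y ⊔ S) t v) ∧
      ∀ v ∈ V₁, A.run (E₀ x ⊔ E₁ y' ⊔ S) t v = A.run (E₀ x' ⊔ E₁ y' ⊔ S) t v := by
  have hswap : ∀ v ∈ V₁, ∀ u,
      (E₀ x ⊔ E₁ y' ⊔ S).Adj u v ↔ (E₀ x' ⊔ E₁ y' ⊔ S).Adj u v := by
    intro v hv u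
    rw [sup_comm (E₀ x), sup_comm (E₀ x')]
    exact h.swap.adj_congr _ _ _ hv
  intro t
  induction t with
  | zero =>
    intro _
    refine ⟨fun v hv => ?_, fun v hv => ?_⟩ <;> simp only [run] <;> congr 1 <;> ext u <;>
      rw [SimpleGraph.mem_neighborSet, SimpleGraph.mem_neighborSet, SimpleGraph.adj_comm,
        SimpleGraph.adj_comm _ v]
    · exact h.adj_congr _ _ _ hv
    · exact hswap v hv u
  | succ t ih =>
    intro ht
    obtain ⟨ih0, ih1⟩ := ih (by omega)
    refine ⟨fun v hv => A.run_succ_congr (ih0 v hv) (fun u => h.adj_congr _ _ _ hv) ?_,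
      fun v hv => A.run_succ_congr (ih1 v hv) (hswap v hv) ?_⟩
    · intro u hu
      rcases h.mem_or u with hu0 | hu1
      · rw [ih0 u hu0]
      · rw [ih1 u hu1, hmsg t ht u v (h.cut_of_adj x y hu1 hv hu)]
    · intro u hu
      rcases h.mem_or u with hu0 | hu1
      · rw [sup_comm (E₀ x')] at hu
        rw [ih0 u hu0, hmsg t ht u v (h.swap.cut_of_adj y' x' hu0 hv hu)]
      · rw [ih1 u hu1]

/-- The messages sent over the cut `S` in the first `T` rounds. -/
noncomputable def cutMessages (A : CongestAlgorithm n B) (T : ℕ) (S G : SimpleGraph (Fin n)) :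
    Fin T × S.Dart → Fin B → Option Bool :=
  fun q => (A.send (A.run G q.1 q.2.fst) q.2.snd).encode

open Classical in
/-- The messages sent over the cut, and whether a node on either side accepts. -/
noncomputable def transcript (A : CongestAlgorithm n B) (T : ℕ) (V₀ V₁ : Set (Fin n))
    (S G : SimpleGraph (Fin n)) : (Fin T × S.Dart → Fin B → Option Bool) × Bool × Bool :=
  (A.cutMessages T S G, decide (∃ v ∈ V₀, A.output (A.run G T v) = true),
    decide (∃ v ∈ V₁, A.output (A.run G T v) = true))

/-- When the transcripts of `(x, y)` and `(x', y')` agree, the left side of the mixed graph runs as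
for `(x, y)` and the right side as for `(x', y')`. The two acceptance bits are recorded separately
so that each is determined by one side. -/
theorem isRectangular_transcript (h : IsCutFamily V₀ V₁ E₀ E₁ S) (A : CongestAlgorithm n B)
    (T : ℕ) : IsRectangular fun x y => A.transcript T V₀ V₁ S (E₀ x ⊔ E₁ y ⊔ S) := by
  intro x y x' y' heq
  simp only [transcript, Prod.mk.injEq, decide_eq_decide] at heq ⊢
  obtain ⟨hm, -, h1⟩ := heq
  have hmsg : ∀ t < T, ∀ u v, S.Adj u v → A.send (A.run (E₀ x ⊔ E₁ y ⊔ S) t u) v =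
      A.send (A.run (E₀ x' ⊔ E₁ y' ⊔ S) t u) v := fun t ht u v huv =>
    Message.encode_injective (congrFun hm (⟨t, ht⟩, ⟨(u, v), huv⟩))
  have hrun := A.run_mixed h T x y x' y' hmsg
  refine ⟨?_, ?_, ?_⟩
  · funext q
    obtain ⟨⟨t, ht⟩, ⟨⟨u, v⟩, huv⟩⟩ := q
    obtain ⟨hr0, hr1⟩ := hrun t ht.le
    simp only [cutMessages]
    rcases h.mem_or u with hu | hu
    · rw [hr0 u hu]
    · rw [hr1 u hu, hmsg t ht u v huv]
  · exact exists_congr fun v => and_congr_right fun hv => by rw [(hrun T le_rfl).1 v hv]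
  · rw [h1]
    exact exists_congr fun v => and_congr_right fun hv => by rw [(hrun T le_rfl).2 v hv]

theorem accepts_iff_transcript (h : IsCutFamily V₀ V₁ E₀ E₁ S) (A : CongestAlgorithm n B)
    (T : ℕ) (G : SimpleGraph (Fin n)) :
    A.Accepts T G ↔ (A.transcript T V₀ V₁ S G).2.1 = true ∨
      (A.transcript T V₀ V₁ S G).2.2 = true := by
  simp only [Accepts, transcript, decide_eq_true_eq, ← exists_or, ← or_and_right]
  exact exists_congr fun v => by simp [h.mem_or v]

end CongestAlgorithm

theorem DeterministicallySolvable.randomizedSolvable {n B T : ℕ} {P : SimpleGraph (Fin n) → Prop}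
    (h : DeterministicallySolvable P B T) : RandomizedSolvable P B T := by
  obtain ⟨A, hA⟩ := h
  refine ⟨Unit, ⊤, Measure.dirac (), inferInstance, fun _ => A, fun G => ⟨trivial, ?_⟩⟩
  simp only [hA G]
  simp
  exact ENNReal.div_le_of_le_mul (by norm_num)

/-- The simulation argument: a cut family whose graphs satisfy `P` iff the two inputs intersect
gives a lower bound on the number of bits that cross the cut. -/
theorem RandomizedSolvable.le_of_isCutFamily {n B T m : ℕ} {P : SimpleGraph (Fin n) → Prop}
    (hP : RandomizedSolvable P B T) {V₀ V₁ : Set (Fin n)}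
    {E₀ E₁ : (Fin m → Bool) → SimpleGraph (Fin n)} {S : SimpleGraph (Fin n)}
    (h : IsCutFamily V₀ V₁ E₀ E₁ S)
    (hdisj : ∀ x y, P (E₀ x ⊔ E₁ y ⊔ S) ↔ ∃ i, x i = true ∧ y i = true) :
    (m : ℝ) ≤ 576 * (2 * S.edgeSet.ncard * ((T : ℝ) * B) * Real.log 3 + Real.log 4) := by
  classical
  obtain ⟨Ω, _, μ, _, A, hA⟩ := hP
  have key := card_le_log_card_transcripts (ι := Fin m)
    (τ := (Fin T × S.Dart → Fin B → Option Bool) × Bool × Bool) μ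
    (fun ω x y => (A ω).Accepts T (E₀ x ⊔ E₁ y ⊔ S))
    (fun ω => ⟨_, fun t => t.2.1 = true ∨ t.2.2 = true, (A ω).isRectangular_transcript h T,
      fun x y => (A ω).accepts_iff_transcript h T _⟩)
    (fun x y => by simpa only [hdisj] using (hA (E₀ x ⊔ E₁ y ⊔ S)).1)
    (fun x y => by simpa only [hdisj] using (hA (E₀ x ⊔ E₁ y ⊔ S)).2)
  rw [Fintype.card_fin] at key
  refine key.trans (mul_le_mul_of_nonneg_left (le_of_eq ?_) (by norm_num))
  -- Messages travel in both directions of a cut edge, so darts are counted; each of the `B` symbols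
  -- of a message has three values, including `none` as padding.
  have hd : Fintype.card S.Dart = 2 * S.edgeSet.ncard := by
    rw [SimpleGraph.dart_card_eq_twice_card_edges, Set.ncard_eq_toFinset_card',
      SimpleGraph.edgeFinset]
  have hc : Fintype.card ((Fin T × S.Dart → Fin B → Option Bool) × Bool × Bool) =
      3 ^ (B * (T * (2 * S.edgeSet.ncard))) * 4 := by
    rw [Fintype.card_prod, Fintype.card_prod, Fintype.card_fun, Fintype.card_fun,
      Fintype.card_prod, Fintype.card_option, Fintype.card_bool, Fintype.card_fin, Fintype.card_fin,
      hd, ← pow_mul]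
  rw [hc]
  push_cast
  rw [Real.log_mul (by positivity) (by norm_num), Real.log_pow]
  push_cast
  ring

section LowerBoundGraph

/-! ### The lower bound graphs -/

/-- Vertices of the lower bound graphs: triangles indexed by words `u : Fin k → Fin s`, and nodes
incident to the cut edges, indexed by a position and a letter. The first coordinate is the side. -/
abbrev HostVertex (k s : ℕ) : Type :=
  (Fin 2 × Fin 2 × Fin 3 × (Fin k → Fin s)) ⊕ (Fin 2 × Fin 2 × Fin k × Fin s)

variable {k s : ℕ}

/-- The part of the lower bound graph on side `a`, with the input `R`. -/
def hostSide (a : Fin 2) (R : (Fin k → Fin s) → (Fin k → Fin s) → Prop) :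
    SimpleGraph (HostVertex k s) where
  Adj
    | .inl (b, i, l, u), .inl (b', i', l', u') => b = a ∧ b' = a ∧
        ((i = i' ∧ u = u' ∧ l ≠ l') ∨
          (l = 0 ∧ l' = 0 ∧ ((i = 0 ∧ i' = 1 ∧ R u u') ∨ (i = 1 ∧ i' = 0 ∧ R u' u))))
    | .inl (b, i, l, u), .inr (b', i', j, c) => b = a ∧ b' = a ∧ i = i' ∧ l = 1 ∧ u j = c
    | .inr (b', i', j, c), .inl (b, i, l, u) => b = a ∧ b' = a ∧ i = i' ∧ l = 1 ∧ u j = c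
    | .inr _, .inr _ => False
  symm := ⟨by
    rintro (⟨b, i, l, u⟩ | ⟨b, i, j, c⟩) (⟨b', i', l', u'⟩ | ⟨b', i', j', c'⟩) h <;>
      simp only at h ⊢ <;> grind⟩
  loopless := ⟨by
    rintro (⟨b, i, l, u⟩ | ⟨b, i, j, c⟩) h <;> simp only at h <;> grind⟩

/-- The cut edges of the lower bound graph. -/
def hostCut (k s : ℕ) : SimpleGraph (HostVertex k s) where
  Adj
    | .inr (b, i, j, c), .inr (b', i', j', c') => b ≠ b' ∧ i = i' ∧ j = j' ∧ c = c'
    | _, _ => False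
  symm := ⟨by
    rintro (⟨b, i, l, u⟩ | ⟨b, i, j, c⟩) (⟨b', i', l', u'⟩ | ⟨b', i', j', c'⟩) h <;>
      simp only at h ⊢ <;> grind⟩
  loopless := ⟨by
    rintro (⟨b, i, l, u⟩ | ⟨b, i, j, c⟩) h <;> simp only at h <;> grind⟩

/-- The lower bound graph with the inputs `R 0` and `R 1`. -/
def hostGraph (R : Fin 2 → (Fin k → Fin s) → (Fin k → Fin s) → Prop) :
    SimpleGraph (HostVertex k s) :=
  hostSide 0 (R 0) ⊔ hostSide 1 (R 1) ⊔ hostCut k s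

namespace hostGraph

variable {R : Fin 2 → (Fin k → Fin s) → (Fin k → Fin s) → Prop}

theorem adj_inl_inl {b b' i i' : Fin 2} {l l' : Fin 3} {u u' : Fin k → Fin s} :
    (hostGraph R).Adj (.inl (b, i, l, u)) (.inl (b', i', l', u')) ↔ b = b' ∧
      ((i = i' ∧ u = u' ∧ l ≠ l') ∨
        (l = 0 ∧ l' = 0 ∧ ((i = 0 ∧ i' = 1 ∧ R b u u') ∨ (i = 1 ∧ i' = 0 ∧ R b u' u)))) := by
  fin_cases b <;> fin_cases b' <;> simp [hostGraph, hostSide, hostCut]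

theorem adj_inl_inr {b b' i i' : Fin 2} {l : Fin 3} {u : Fin k → Fin s} {j : Fin k} {c : Fin s} :
    (hostGraph R).Adj (.inl (b, i, l, u)) (.inr (b', i', j, c)) ↔
      b = b' ∧ i = i' ∧ l = 1 ∧ u j = c := by
  fin_cases b <;> fin_cases b' <;> simp [hostGraph, hostSide, hostCut]

theorem adj_inr_inl {b b' i i' : Fin 2} {l : Fin 3} {u : Fin k → Fin s} {j : Fin k} {c : Fin s} :
    (hostGraph R).Adj (.inr (b', i', j, c)) (.inl (b, i, l, u)) ↔
      b = b' ∧ i = i' ∧ l = 1 ∧ u j = c := by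
  rw [SimpleGraph.adj_comm, adj_inl_inr]

theorem adj_inr_inr {b b' i i' : Fin 2} {j j' : Fin k} {c c' : Fin s} :
    (hostGraph R).Adj (.inr (b, i, j, c)) (.inr (b', i', j', c')) ↔
      b ≠ b' ∧ i = i' ∧ j = j' ∧ c = c' := by
  simp [hostGraph, hostSide, hostCut]

/-- Every triangle of the lower bound graph is one of the indexed triangles. -/
theorem triangle {v : Fin 3 → HostVertex k s}
    (h : ∀ l l', l ≠ l' → (hostGraph R).Adj (v l) (v l')) :
    ∃ b i u, ∃ g : Fin 3 → Fin 3, ∀ l, v l = .inl (b, i, g l, u) := by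
  have h01 := h 0 1 (by decide)
  have h02 := h 0 2 (by decide)
  have h12 := h 1 2 (by decide)
  rcases e0 : v 0 with ⟨b0, i0, l0, u0⟩ | ⟨b0, i0, j0, c0⟩ <;>
  rcases e1 : v 1 with ⟨b1, i1, l1, u1⟩ | ⟨b1, i1, j1, c1⟩ <;>
  rcases e2 : v 2 with ⟨b2, i2, l2, u2⟩ | ⟨b2, i2, j2, c2⟩ <;>
  rw [e0, e1] at h01 <;> rw [e0, e2] at h02 <;> rw [e1, e2] at h12 <;>
  simp only [adj_inl_inl, adj_inl_inr, adj_inr_inl, adj_inr_inr] at h01 h02 h12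
  -- Input edges join number `0` to number `1`, so they close no triangle. Letter nodes lie in none:
  -- their triangle neighbours all have label `1` and are pairwise nonadjacent, and cut neighbours
  -- lie on opposite sides.
  · refine ⟨b0, i0, u0, ![l0, l1, l2], fun l => ?_⟩
    have : b1 = b0 ∧ i1 = i0 ∧ u1 = u0 ∧ b2 = b0 ∧ i2 = i0 ∧ u2 = u0 := by grind
    obtain ⟨rfl, rfl, rfl, rfl, rfl, rfl⟩ := this
    fin_cases l <;> simp [e0, e1, e2]
  all_goals grind

/-- Only injectivity is available, so each place in the host must be forced by counting: a host
triangle is filled by the image of one pattern triangle, and the `k` paths use up all `k` positions.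
-/
theorem exists_common_of_hom (hk : 1 ≤ k) (f : patternGraph k →g hostGraph R)
    (hf : Function.Injective f) : ∃ u v, R 0 u v ∧ R 1 u v := by
  have htri : ∀ a i : Fin 2, ∃ b ι u, ∃ g : Fin 3 → Fin 3,
      ∀ l, f (.inl (a, i, l)) = .inl (b, ι, g l, u) := fun a i =>
    triangle fun l l' hl => f.map_adj (show a = a ∧ _ from ⟨rfl, .inl ⟨rfl, hl⟩⟩)
  choose b ι u g hg using htri
  have hginj : ∀ a i, Function.Injective (g a i) := by
    intro a i l l' h
    have : (Sum.inl (a, i, l) : PatternVertex k) = .inl (a, i, l') :=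
      hf (by rw [hg, hg, h])
    simpa using this
  have hgsurj : ∀ a i, Function.Surjective (g a i) := fun a i =>
    Finite.surjective_of_injective (hginj a i)
  have hnot : ∀ a i l (w : PatternVertex k), (∀ l', w ≠ .inl (a, i, l')) →
      f w ≠ .inl (b a i, ι a i, l, u a i) := by
    intro a i l w hw h
    obtain ⟨l', rfl⟩ := hgsurj a i l
    rw [← hg] at h
    exact hw l' (hf h)
  -- A bridge cannot stay inside a host triangle, whose nodes are already taken, so it is an input
  -- edge.
  have hbit : ∀ a i i', i ≠ i' → b a i = b a i' ∧ g a i 0 = 0 ∧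
      ((ι a i = 0 ∧ ι a i' = 1 ∧ R (b a i) (u a i) (u a i')) ∨
        (ι a i = 1 ∧ ι a i' = 0 ∧ R (b a i) (u a i') (u a i))) := by
    intro a i i' hi
    have h := f.map_adj (show (patternGraph k).Adj (.inl (a, i, 0)) (.inl (a, i', 0)) from
      ⟨rfl, .inr ⟨hi, rfl, rfl⟩⟩)
    rw [hg, hg, adj_inl_inl] at h
    obtain ⟨h0, ⟨h1, h2, -⟩ | ⟨h1, -, h2⟩⟩ := h
    · refine absurd (hg a i' 0) ?_
      rw [← h0, ← h1, ← h2]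
      exact hnot a i _ _ fun l' hl => hi (by simp at hl; exact hl.1.symm)
    · exact ⟨h0, h1, h2⟩
  have hg0 : ∀ a i, g a i 0 = 0 := fun a i => (hbit a i (i + 1) (by fin_cases i <;> decide)).2.1
  have hadj1 : ∀ a i p, (hostGraph R).Adj (.inl (b a i, ι a i, g a i 1, u a i))
      (f (.inr (a, i, p))) := by
    intro a i p
    rw [← hg]
    exact f.map_adj (show a = a ∧ i = i ∧ (1 : Fin 3) = 1 from ⟨rfl, rfl, rfl⟩)
  -- Label `0` is occupied by the bridge end, and nodes of nonzero label have no neighbours outside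
  -- their triangle except letter nodes.
  have hinner : ∀ a i p, ∃ j, f (.inr (a, i, p)) = .inr (b a i, ι a i, j, u a i j) := by
    intro a i p
    have h := hadj1 a i p
    have hn := fun l => hnot a i l (.inr (a, i, p)) (by simp)
    have hne : g a i 1 ≠ 0 := by
      rw [← hg0 a i]
      exact fun h => absurd (hginj a i h) (by decide)
    rcases e : f (.inr (a, i, p)) with ⟨b', i', l', u'⟩ | ⟨b', i', j', c'⟩
    · rw [e, adj_inl_inl] at h
      obtain ⟨rfl, ⟨rfl, rfl, -⟩ | ⟨h1, -⟩⟩ := h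
      · exact absurd e (hn l')
      · exact absurd h1 hne
    · rw [e, adj_inl_inr] at h
      obtain ⟨rfl, rfl, -, rfl⟩ := h
      exact ⟨j', rfl⟩
  choose J hJ using hinner
  have hcut : ∀ i p, b 0 i ≠ b 1 i ∧ ι 0 i = ι 1 i ∧ J 0 i p = J 1 i p ∧
      u 0 i (J 0 i p) = u 1 i (J 1 i p) := by
    intro i p
    have h := f.map_adj (show (patternGraph k).Adj (.inr (0, i, p)) (.inr (1, i, p)) from
      ⟨by decide, rfl, rfl⟩)
    rwa [hJ, hJ, adj_inr_inr] at h
  have hu : ∀ i, u 0 i = u 1 i := by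
    intro i
    have hinj : Function.Injective (J 0 i) := by
      intro p q h
      have : (Sum.inr (0, i, p) : PatternVertex k) = .inr (0, i, q) := hf (by rw [hJ, hJ, h])
      simpa using this
    funext j
    obtain ⟨p, rfl⟩ := Finite.surjective_of_injective hinj j
    obtain ⟨-, -, h1, h2⟩ := hcut i p
    rw [h2, ← h1]
  obtain ⟨c1, c2, -, -⟩ := hcut 0 ⟨0, hk⟩
  obtain ⟨d1, d2, -, -⟩ := hcut 1 ⟨0, hk⟩
  obtain ⟨-, -, hb0⟩ := hbit 0 0 1 (by decide)
  obtain ⟨-, -, hb1⟩ := hbit 1 0 1 (by decide)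
  rw [← hu 0, ← hu 1, ← c2, ← d2] at hb1
  -- The copy may exchange the two sides or the two triangle numbers. Both ends of the linked
  -- triangles carry the same number, so the two input edges name the same ordered pair.
  have hcases : (b 0 0 = 0 ∧ b 1 0 = 1) ∨ (b 0 0 = 1 ∧ b 1 0 = 0) := by
    generalize b 0 0 = p at *
    generalize b 1 0 = q at *
    clear * - c1
    revert p q
    decide
  rcases hcases with ⟨e0, e1⟩ | ⟨e0, e1⟩ <;> rw [e0] at hb0 <;> rw [e1] at hb1 <;>
    rcases hb0 with ⟨z0, z1, hr⟩ | ⟨z0, z1, hr⟩ <;> rw [z0, z1] at hb1 <;>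
    simp only [Fin.isValue, true_and, zero_ne_one, one_ne_zero, false_and, or_false, false_or] at hb1
  · exact ⟨_, _, hr, hb1⟩
  · exact ⟨_, _, hr, hb1⟩
  · exact ⟨_, _, hb1, hr⟩
  · exact ⟨_, _, hb1, hr⟩

theorem nonempty_embedding {u v : Fin k → Fin s} (h0 : R 0 u v) (h1 : R 1 u v) :
    Nonempty (patternGraph k ↪g hostGraph R) := by
  let w : Fin 2 → Fin k → Fin s := ![u, v]
  have hR : ∀ a, R a (w 0) (w 1) := by
    intro a; fin_cases a
    · exact h0
    · exact h1
  let f : PatternVertex k → HostVertex k s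
    | .inl (a, i, l) => .inl (a, i, l, w i)
    | .inr (a, i, p) => .inr (a, i, p, w i p)
  have hinj : Function.Injective f := by
    rintro (⟨a, i, l⟩ | ⟨a, i, p⟩) (⟨a', i', l'⟩ | ⟨a', i', p'⟩) h <;> simp [f] at h ⊢ <;> tauto
  have hadj : ∀ x y, (hostGraph R).Adj (f x) (f y) ↔ (patternGraph k).Adj x y := by
    rintro (⟨a, i, l⟩ | ⟨a, i, p⟩) (⟨a', i', l'⟩ | ⟨a', i', p'⟩) <;>
      simp only [f, adj_inl_inl, adj_inl_inr, adj_inr_inl, adj_inr_inr, patternGraph]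
    · fin_cases i <;> fin_cases i' <;> simp [hR]
    · grind
    · grind
    · grind
  exact ⟨⟨⟨f, hinj⟩, hadj _ _⟩⟩

end hostGraph

end LowerBoundGraph

/-! ### Placing the host graph on `Fin n` -/

section LowerBoundGraph

variable {k s : ℕ}

theorem patternGraph.exists_adj (w : PatternVertex k) : ∃ w', (patternGraph k).Adj w w' := by
  rcases w with ⟨a, i, l⟩ | ⟨a, i, p⟩
  · exact ⟨.inl (a, i, l + 1), rfl, .inl ⟨rfl, by fin_cases l <;> decide⟩⟩
  · exact ⟨.inl (a, i, 1), rfl, rfl, rfl⟩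

theorem ncard_edgeSet_hostCut (k s : ℕ) : (hostCut k s).edgeSet.ncard = 2 * (k * s) := by
  let g : Fin 2 × Fin k × Fin s → Sym2 (HostVertex k s) := fun q =>
    s(.inr (0, q), .inr (1, q))
  have hg : Function.Injective g := by
    intro q q' h
    simp only [g, Sym2.eq_iff, Sum.inr.injEq, Prod.mk.injEq] at h
    rcases h with h | h
    · exact h.1.2
    · exact absurd h.1.1 (by decide)
  have hr : (hostCut k s).edgeSet = Set.range g := by
    ext z
    induction z with | _ x y
    rw [SimpleGraph.mem_edgeSet]
    constructor
    · intro h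
      rcases x with ⟨a, i, l, u⟩ | ⟨a, i, j, c⟩ <;> rcases y with ⟨a', i', l', u'⟩ | ⟨a', i', j', c'⟩
        <;> simp only [hostCut] at h
      obtain ⟨h, rfl, rfl, rfl⟩ := h
      refine ⟨(i, j, c), ?_⟩
      fin_cases a <;> fin_cases a' <;> simp [g, Sym2.eq_swap] at h ⊢
    · rintro ⟨⟨i, j, c⟩, h⟩
      have hadj : (hostCut k s).Adj (.inr (0, i, j, c)) (.inr (1, i, j, c)) :=
        ⟨by decide, rfl, rfl, rfl⟩
      rw [← SimpleGraph.mem_edgeSet] at hadj ⊢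
      rw [← h]
      exact hadj
  rw [hr, Set.ncard_range_of_injective hg]
  simp

/-- The side of a vertex of the lower bound graph. -/
def HostVertex.side : HostVertex k s → Fin 2
  | .inl (a, _) => a
  | .inr (a, _) => a

theorem side_of_hostSide_adj {a : Fin 2} {R : (Fin k → Fin s) → (Fin k → Fin s) → Prop}
    {u v : HostVertex k s} (h : (hostSide a R).Adj u v) :
    HostVertex.side u = a ∧ HostVertex.side v = a := by
  rcases u with ⟨b, i, l, u⟩ | ⟨b, i, j, c⟩ <;> rcases v with ⟨b', i', l', u'⟩ | ⟨b', i', j', c'⟩ <;>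
    simp only [hostSide] at h
  all_goals first | exact ⟨h.1, h.2.1⟩ | exact ⟨h.2.1, h.1⟩

theorem side_ne_of_hostCut_adj {u v : HostVertex k s} (h : (hostCut k s).Adj u v) :
    HostVertex.side u ≠ HostVertex.side v := by
  rcases u with ⟨b, i, l, u⟩ | ⟨b, i, j, c⟩ <;> rcases v with ⟨b', i', l', u'⟩ | ⟨b', i', j', c'⟩ <;>
    simp only [hostCut] at h
  exact h.1

theorem map_hostGraph {n : ℕ} (e : HostVertex k s ↪ Fin n)
    (R : Fin 2 → (Fin k → Fin s) → (Fin k → Fin s) → Prop) :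
    (hostGraph R).map e =
      (hostSide 0 (R 0)).map e ⊔ (hostSide 1 (R 1)).map e ⊔ (hostCut k s).map e := by
  ext u v
  simp only [hostGraph, SimpleGraph.map_adj, SimpleGraph.sup_adj, ← exists_or, or_and_right]

theorem HasCopy.exists_common {n : ℕ} (hk : 1 ≤ k) (e : HostVertex k s ↪ Fin n)
    {R : Fin 2 → (Fin k → Fin s) → (Fin k → Fin s) → Prop}
    (h : HasCopy (patternGraph k) n ((hostGraph R).map e)) : ∃ u v, R 0 u v ∧ R 1 u v := by
  obtain ⟨f⟩ := h
  -- The remaining vertices of `Fin n` are isolated, while the pattern has no isolated vertex, so a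
  -- copy avoids them.
  have hrange : ∀ w, ∃ v, e v = f w := by
    intro w
    obtain ⟨w', hw'⟩ := patternGraph.exists_adj w
    obtain ⟨v, _, _, hv, _⟩ := (SimpleGraph.map_adj e _ _ _).1 (f.toHom.map_adj hw')
    exact ⟨v, hv⟩
  choose g hg using hrange
  refine hostGraph.exists_common_of_hom hk ⟨g, ?_⟩ ?_
  · intro w w' hw
    have := f.toHom.map_adj hw
    change ((hostGraph R).map e).Adj (f w) (f w') at this
    rwa [← hg, ← hg, SimpleGraph.map_adj_apply] at this
  · intro w w' hw
    apply f.injective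
    change f w = f w'
    rw [← hg, ← hg]
    exact congrArg e hw

theorem hasInducedCopy_of_common {n : ℕ} (e : HostVertex k s ↪ Fin n)
    {R : Fin 2 → (Fin k → Fin s) → (Fin k → Fin s) → Prop} {u v : Fin k → Fin s}
    (h0 : R 0 u v) (h1 : R 1 u v) :
    HasInducedCopy (patternGraph k) n ((hostGraph R).map e) := by
  obtain ⟨f⟩ := hostGraph.nonempty_embedding h0 h1
  exact ⟨(SimpleGraph.Embedding.map e (hostGraph R)).comp f⟩

theorem card_hostVertex_le {n : ℕ} (hk : 1 ≤ k) (h : (12 + 4 * k) * s ^ k ≤ n) :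
    Fintype.card (HostVertex k s) ≤ n := by
  simp only [Fintype.card_sum, Fintype.card_prod, Fintype.card_fin, Fintype.card_fun]
  have : s ≤ s ^ k := Nat.le_self_pow (by omega) s
  nlinarith

/-- The lower bound graphs on `Fin n`. -/
theorem exists_isCutFamily {n : ℕ} (hk : 1 ≤ k) (h : (12 + 4 * k) * s ^ k ≤ n) :
    ∃ (V₀ V₁ : Set (Fin n)) (E₀ E₁ : (Fin (s ^ k * s ^ k) → Bool) → SimpleGraph (Fin n))
      (S : SimpleGraph (Fin n)), IsCutFamily V₀ V₁ E₀ E₁ S ∧ S.edgeSet.ncard = 2 * (k * s) ∧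
      ∀ x y, (HasCopy (patternGraph k) n (E₀ x ⊔ E₁ y ⊔ S) ↔ ∃ i, x i = true ∧ y i = true) ∧
        (HasInducedCopy (patternGraph k) n (E₀ x ⊔ E₁ y ⊔ S) ↔
          ∃ i, x i = true ∧ y i = true) := by
  obtain ⟨e⟩ : Nonempty (HostVertex k s ↪ Fin n) :=
    Function.Embedding.nonempty_of_card_le (by simpa using card_hostVertex_le hk h)
  let φ : (Fin k → Fin s) × (Fin k → Fin s) ≃ Fin (s ^ k * s ^ k) :=
    Fintype.equivFinOfCardEq (by simp)
  let rel : (Fin (s ^ k * s ^ k) → Bool) → (Fin k → Fin s) → (Fin k → Fin s) → Prop :=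
    fun x u v => x (φ (u, v)) = true
  have hside : ∀ (a : Fin 2) x u v, ((hostSide a (rel x)).map e).Adj u v →
      ∃ u' v', e u' = u ∧ e v' = v ∧ HostVertex.side u' = a ∧ HostVertex.side v' = a := by
    intro a x u v huv
    obtain ⟨u', v', hadj, rfl, rfl⟩ := (SimpleGraph.map_adj e _ _ _).1 huv
    exact ⟨u', v', rfl, rfl, side_of_hostSide_adj hadj⟩
  have hmem : ∀ v, e v ∈ e '' {v | HostVertex.side v = 1} ↔ HostVertex.side v = 1 := fun v =>
    e.injective.mem_set_image
  -- Taking a complement puts the isolated padding vertices on the left side.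
  refine ⟨(e '' {v | HostVertex.side v = 1})ᶜ, e '' {v | HostVertex.side v = 1},
    fun x => (hostSide 0 (rel x)).map e, fun x => (hostSide 1 (rel x)).map e,
    (hostCut k s).map e, ⟨disjoint_compl_left, Set.compl_union_self _, ?_, ?_, ?_⟩, ?_, ?_⟩
  · intro x u v huv
    obtain ⟨u', v', rfl, rfl, hu, hv⟩ := hside 0 x u v huv
    simp only [Set.mem_compl_iff, hmem, hu, hv]
    decide
  · intro x u v huv
    obtain ⟨u', v', rfl, rfl, hu, hv⟩ := hside 1 x u v huv
    simp only [hmem, hu, hv, and_self]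
  · intro u v huv
    obtain ⟨u', v', hadj, rfl, rfl⟩ := (SimpleGraph.map_adj e _ _ _).1 huv
    have hne := side_ne_of_hostCut_adj hadj
    simp only [Set.mem_compl_iff, hmem]
    generalize HostVertex.side u' = a at hne
    generalize HostVertex.side v' = b at hne
    revert a b
    decide
  · rw [SimpleGraph.edgeSet_map, Set.ncard_image_of_injective _ (Function.Embedding.injective _),
      ncard_edgeSet_hostCut]
  · intro x y
    have hG := map_hostGraph e ![rel x, rel y]
    simp only [Matrix.cons_val_zero, Matrix.cons_val_one] at hG
    rw [← hG]
    have h1 : HasInducedCopy (patternGraph k) n ((hostGraph ![rel x, rel y]).map e) →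
        HasCopy (patternGraph k) n ((hostGraph ![rel x, rel y]).map e) :=
      fun ⟨f⟩ => ⟨f.toCopy⟩
    have h2 : HasCopy (patternGraph k) n ((hostGraph ![rel x, rel y]).map e) →
        ∃ i, x i = true ∧ y i = true := by
      intro hc
      obtain ⟨u, v, hu, hv⟩ := hc.exists_common hk e
      exact ⟨φ (u, v), hu, hv⟩
    have h3 : (∃ i, x i = true ∧ y i = true) →
        HasInducedCopy (patternGraph k) n ((hostGraph ![rel x, rel y]).map e) := by
      rintro ⟨i, hx, hy⟩
      obtain ⟨⟨u, v⟩, rfl⟩ := φ.surjective i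
      exact hasInducedCopy_of_common e hx hy
    exact ⟨⟨h2, fun h => h1 (h3 h)⟩, ⟨fun h => h2 (h1 h), h3⟩⟩

end LowerBoundGraph

section Parameters

/-! ### Parameters -/

/-- The alphabet size of the lower bound graph on `n` vertices. -/
def alphabetSize (k n : ℕ) : ℕ := Nat.findGreatest (fun s => (12 + 4 * k) * s ^ k ≤ n) n

variable {k : ℕ}

theorem alphabetSize_pow_le (hk : 1 ≤ k) (n : ℕ) : (12 + 4 * k) * alphabetSize k n ^ k ≤ n :=
  Nat.findGreatest_spec (P := fun s => (12 + 4 * k) * s ^ k ≤ n) (Nat.zero_le n)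
    (by rw [zero_pow (by omega)]; omega)

theorem lt_alphabetSize_succ_pow (hk : 1 ≤ k) (n : ℕ) :
    n < (12 + 4 * k) * (alphabetSize k n + 1) ^ k := by
  by_cases h : alphabetSize k n + 1 ≤ n
  · exact not_le.mp (Nat.findGreatest_is_greatest
      (P := fun s => (12 + 4 * k) * s ^ k ≤ n) (Nat.lt_succ_self _) h)
  -- Beyond the search range of `Nat.findGreatest` the inequality holds anyway, as the base alone
  -- exceeds `n`.
  · have : alphabetSize k n + 1 ≤ (alphabetSize k n + 1) ^ k := Nat.le_self_pow (by omega) _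
    nlinarith

/-- The constant relating the number of vertices and the number of words. -/
def sizeRatio (k : ℕ) : ℕ := (12 + 4 * k) * 2 ^ k

theorem le_sizeRatio_mul (hk : 1 ≤ k) {n : ℕ} (hn : 12 + 4 * k ≤ n) :
    n ≤ sizeRatio k * alphabetSize k n ^ k := by
  have h := lt_alphabetSize_succ_pow hk n
  have h1 : 1 ≤ alphabetSize k n := by
    by_contra h0
    have : alphabetSize k n = 0 := by omega
    rw [this] at h
    simp at h
    omega
  calc n ≤ (12 + 4 * k) * (alphabetSize k n + 1) ^ k := h.le
    _ ≤ (12 + 4 * k) * (2 * alphabetSize k n) ^ k := by gcongr; omega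
    _ = _ := by rw [mul_pow, sizeRatio]; ring

theorem alphabetSize_pow_le' (hk : 1 ≤ k) (n : ℕ) : alphabetSize k n ^ k ≤ n := by
  nlinarith [alphabetSize_pow_le hk n, Nat.zero_le (alphabetSize k n ^ k)]

theorem sizeRatio_pos (k : ℕ) : (0 : ℝ) < sizeRatio k := by
  rw [sizeRatio]; positivity

theorem alphabetSize_le_rpow (hk : 1 ≤ k) (n : ℕ) :
    (alphabetSize k n : ℝ) ≤ (n : ℝ) ^ (1 / (k : ℝ)) := by
  have h : ((alphabetSize k n : ℝ)) ^ k ≤ n := by exact_mod_cast alphabetSize_pow_le' hk n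
  have h2 := Real.rpow_le_rpow (by positivity) h (show (0 : ℝ) ≤ 1 / k by positivity)
  rwa [one_div, Real.pow_rpow_inv_natCast (by positivity) (by omega), ← one_div] at h2

theorem rpow_le_mul_alphabetSize (hk : 1 ≤ k) {n : ℕ} (hn : 12 + 4 * k ≤ n) :
    (n : ℝ) ^ (1 / (k : ℝ)) ≤ (sizeRatio k : ℝ) ^ (1 / (k : ℝ)) * alphabetSize k n := by
  have h : (n : ℝ) ≤ sizeRatio k * (alphabetSize k n : ℝ) ^ k := by
    exact_mod_cast le_sizeRatio_mul hk hn
  have h2 := Real.rpow_le_rpow (by positivity) h (show (0 : ℝ) ≤ 1 / k by positivity)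
  rw [Real.mul_rpow (by positivity) (by positivity)] at h2
  nth_rewrite 3 [one_div] at h2
  rwa [Real.pow_rpow_inv_natCast (by positivity) (by omega)] at h2

theorem sq_le_mul_card_words (hk : 1 ≤ k) {n : ℕ} (hn : 12 + 4 * k ≤ n) :
    (n : ℝ) ^ 2 ≤ (sizeRatio k : ℝ) ^ 2 *
      ((alphabetSize k n ^ k * alphabetSize k n ^ k : ℕ) : ℝ) := by
  have h : (n : ℝ) ≤ sizeRatio k * (alphabetSize k n : ℝ) ^ k := by
    exact_mod_cast le_sizeRatio_mul hk hn
  push_cast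
  calc (n : ℝ) ^ 2 ≤ (sizeRatio k * (alphabetSize k n : ℝ) ^ k) ^ 2 := by gcongr
    _ = _ := by ring

theorem isTheta_card_words (hk : 1 ≤ k) :
    (fun n => ((alphabetSize k n ^ k * alphabetSize k n ^ k : ℕ) : ℝ)) =Θ[atTop]
      (fun n : ℕ => (n : ℝ) ^ 2) := by
  constructor
  · refine IsBigO.of_bound 1 (Eventually.of_forall fun n => ?_)
    rw [Real.norm_of_nonneg (by positivity), Real.norm_of_nonneg (by positivity), one_mul, sq]
    exact_mod_cast Nat.mul_le_mul (alphabetSize_pow_le' hk n) (alphabetSize_pow_le' hk n)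
  · refine IsBigO.of_bound ((sizeRatio k : ℝ) ^ 2) ?_
    filter_upwards [eventually_ge_atTop (12 + 4 * k)] with n hn
    rw [Real.norm_of_nonneg (by positivity), Real.norm_of_nonneg (by positivity)]
    exact sq_le_mul_card_words hk hn

theorem isTheta_cutSize (hk : 1 ≤ k) :
    (fun n => ((2 * (k * alphabetSize k n) : ℕ) : ℝ)) =Θ[atTop]
      (fun n : ℕ => (n : ℝ) ^ (1 / (k : ℝ))) := by
  have hk' : (1 : ℝ) ≤ k := by exact_mod_cast hk
  constructor
  · refine IsBigO.of_bound (2 * k) (Eventually.of_forall fun n => ?_)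
    rw [Real.norm_of_nonneg (by positivity), Real.norm_of_nonneg (by positivity)]
    push_cast
    rw [← mul_assoc]
    exact mul_le_mul_of_nonneg_left (alphabetSize_le_rpow hk n) (by positivity)
  · refine IsBigO.of_bound ((sizeRatio k : ℝ) ^ (1 / (k : ℝ))) ?_
    filter_upwards [eventually_ge_atTop (12 + 4 * k)] with n hn
    rw [Real.norm_of_nonneg (by positivity), Real.norm_of_nonneg (by positivity)]
    refine (rpow_le_mul_alphabetSize hk hn).trans
      (mul_le_mul_of_nonneg_left ?_ (Real.rpow_nonneg (sizeRatio_pos k).le _))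
    push_cast
    nlinarith [(alphabetSize k n).cast_nonneg (α := ℝ)]

theorem disj_eq_true_iff {m : ℕ} (x y : Fin m → Bool) :
    disj m x y = true ↔ ¬ ∃ i, x i = true ∧ y i = true := by
  simp [disj]

theorem exists_isLowerBoundFamily (hk : 1 ≤ k) : ∃ (m C : ℕ → ℕ)
    (G : ∀ n : ℕ, (Fin (m n) → Bool) → (Fin (m n) → Bool) → SimpleGraph (Fin n)),
    (fun n => (m n : ℝ)) =Θ[atTop] (fun n : ℕ => (n : ℝ) ^ 2) ∧
    (fun n => (C n : ℝ)) =Θ[atTop] (fun n : ℕ => (n : ℝ) ^ (1 / (k : ℝ))) ∧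
    IsLowerBoundFamily (fun n g => ¬ HasCopy (patternGraph k) n g) m C (fun n => disj (m n)) G ∧
    IsLowerBoundFamily (fun n g => ¬ HasInducedCopy (patternGraph k) n g) m C
      (fun n => disj (m n)) G := by
  choose V₀ V₁ E₀ E₁ S hfam hcut hcopy using fun n =>
    exists_isCutFamily (n := n) hk (alphabetSize_pow_le hk n)
  refine ⟨fun n => alphabetSize k n ^ k * alphabetSize k n ^ k,
    fun n => 2 * (k * alphabetSize k n), fun n x y => E₀ n x ⊔ E₁ n y ⊔ S n,
    isTheta_card_words hk, isTheta_cutSize hk, ⟨0, fun n _ => ⟨fun x y => ?_, ?_⟩⟩,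
    ⟨0, fun n _ => ⟨fun x y => ?_, ?_⟩⟩⟩
  · rw [disj_eq_true_iff]
    exact not_congr (hcopy n x y).1
  · exact ⟨V₀ n, V₁ n, E₀ n, E₁ n, S n, (hfam n).disjoint, (hfam n).cover, (hfam n).left,
      (hfam n).right, (hfam n).cut, hcut n, fun _ _ => rfl⟩
  · rw [disj_eq_true_iff]
    exact not_congr (hcopy n x y).2
  · exact ⟨V₀ n, V₁ n, E₀ n, E₁ n, S n, (hfam n).disjoint, (hfam n).cover, (hfam n).left,
      (hfam n).right, (hfam n).cut, hcut n, fun _ _ => rfl⟩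

theorem exists_round_lower_bound (hk : 1 ≤ k) :
    ∃ c : ℝ, 0 < c ∧ ∃ n₀ : ℕ, ∀ n ≥ n₀, ∀ B T : ℕ,
      ∀ P : SimpleGraph (Fin n) → Prop,
        P = HasCopy (patternGraph k) n ∨ P = HasInducedCopy (patternGraph k) n →
        DeterministicallySolvable P B T ∨ RandomizedSolvable P B T →
        c * (n : ℝ) ^ (2 - 1 / (k : ℝ)) ≤ (T : ℝ) * (B : ℝ) := by
  have hD := sizeRatio_pos k
  have hk' : (0 : ℝ) < k := by exact_mod_cast hk
  refine ⟨1 / (9216 * k * (sizeRatio k : ℝ) ^ 2), by positivity,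
    max (12 + 4 * k) (60 * sizeRatio k), fun n hn B T P hP hsol => ?_⟩
  have hn1 : 12 + 4 * k ≤ n := le_of_max_le_left hn
  have hn2 : 60 * (sizeRatio k : ℝ) ≤ n := by exact_mod_cast le_of_max_le_right hn
  have hrand : RandomizedSolvable P B T := hsol.elim (·.randomizedSolvable) id
  obtain ⟨V₀, V₁, E₀, E₁, S, hfam, hcut, hcopy⟩ :=
    exists_isCutFamily (n := n) hk (alphabetSize_pow_le hk n)
  have hdisj : ∀ x y, P (E₀ x ⊔ E₁ y ⊔ S) ↔ ∃ i, x i = true ∧ y i = true := by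
    intro x y
    rcases hP with rfl | rfl
    · exact (hcopy x y).1
    · exact (hcopy x y).2
  have key := hrand.le_of_isCutFamily hfam hdisj
  rw [hcut] at key
  have hm := sq_le_mul_card_words hk hn1
  set M : ℝ := ((alphabetSize k n ^ k * alphabetSize k n ^ k : ℕ) : ℝ)
  have hM : 3600 ≤ M := by
    have h1 : (60 * (sizeRatio k : ℝ)) ^ 2 ≤ (n : ℝ) ^ 2 := by gcongr
    have h2 : (sizeRatio k : ℝ) ^ 2 * 3600 ≤ (sizeRatio k : ℝ) ^ 2 * M := by
      calc _ = (60 * (sizeRatio k : ℝ)) ^ 2 := by ring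
        _ ≤ _ := h1.trans hm
    exact le_of_mul_le_mul_left h2 (by positivity)
  have hl3 : Real.log 3 ≤ 2 := by
    have := Real.log_le_sub_one_of_pos (show (0 : ℝ) < 3 by norm_num); linarith
  have hl4 : Real.log 4 ≤ 3 := by
    have := Real.log_le_sub_one_of_pos (show (0 : ℝ) < 4 by norm_num); linarith
  set r : ℝ := (n : ℝ) ^ (1 / (k : ℝ)) with hr
  have hs : (alphabetSize k n : ℝ) ≤ r := alphabetSize_le_rpow hk n
  have hnpos : (0 : ℝ) < n := by
    have : 0 < n := by omega
    exact_mod_cast this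
  have hrpos : 0 < r := Real.rpow_pos_of_pos hnpos _
  have hTB : (0 : ℝ) ≤ (T : ℝ) * B := by positivity
  push_cast at key
  have h3 : 2 * (2 * ((k : ℝ) * alphabetSize k n)) * ((T : ℝ) * B) * Real.log 3 ≤
      2 * (2 * ((k : ℝ) * r)) * ((T : ℝ) * B) * 2 := by gcongr
  -- The bounds on the logarithms give `M ≤ 4608 * k * r * (T * B) + 1728`, and `M ≥ 3600` absorbs
  -- the last term into `M / 2`.
  have h4 : M ≤ 9216 * k * r * (T * B) := by nlinarith
  have h5 : (n : ℝ) ^ 2 ≤ (9216 * k * (sizeRatio k : ℝ) ^ 2) * (T * B) * r := by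
    refine hm.trans ((mul_le_mul_of_nonneg_left h4 (by positivity)).trans (le_of_eq (by ring)))
  have h6 : (n : ℝ) ^ (2 - 1 / (k : ℝ)) = (n : ℝ) ^ 2 / r := by
    rw [Real.rpow_sub hnpos, hr]
    norm_cast
  rw [h6, one_div, inv_mul_le_iff₀ (by positivity), div_le_iff₀ hrpos]
  exact h5

theorem exists_round_lower_bound_log (hk : 1 ≤ k) (β : ℝ) (hβ : 0 < β) :
    ∃ c : ℝ, 0 < c ∧ ∃ n₀ : ℕ, ∀ n ≥ n₀, ∀ B T : ℕ,
      (B : ℝ) ≤ β * Real.log n →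
      ∀ P : SimpleGraph (Fin n) → Prop,
        P = HasCopy (patternGraph k) n ∨ P = HasInducedCopy (patternGraph k) n →
        DeterministicallySolvable P B T ∨ RandomizedSolvable P B T →
        c * (n : ℝ) ^ (2 - 1 / (k : ℝ)) / Real.log n ≤ (T : ℝ) := by
  obtain ⟨c, hc, n₀, h⟩ := exists_round_lower_bound hk
  refine ⟨c / β, by positivity, max n₀ 2, fun n hn B T hB P hP hsol => ?_⟩
  have hlog : 0 < Real.log n := by
    have : 2 ≤ n := le_of_max_le_right hn
    exact Real.log_pos (by exact_mod_cast this)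
  have h1 := h n (le_of_max_le_left hn) B T P hP hsol
  rw [div_le_iff₀ hlog, div_mul_eq_mul_div, div_le_iff₀ hβ]
  calc c * (n : ℝ) ^ (2 - 1 / (k : ℝ)) ≤ T * B := h1
    _ ≤ T * (β * Real.log n) := by gcongr
    _ = _ := by ring

end Parameters

/-! ### Treewidth -/

namespace SimpleGraph

section Median

variable {ι : Type*} {G : SimpleGraph ι}

/-- A walk is cut at its first visit to the set and then made into a path. -/
theorem Walk.exists_isPath_to_set (S : Set ι) {l i : ι} (q : G.Walk l i) (hi : i ∈ S) :
    ∃ m ∈ S, ∃ q' : G.Walk l m, q'.IsPath ∧ ∀ x ∈ q'.support, x ∈ S → x = m := by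
  classical
  induction q with
  | nil => exact ⟨_, hi, .nil, .nil, by simp⟩
  | @cons u v w h q ih =>
    by_cases hu : u ∈ S
    · exact ⟨u, hu, .nil, .nil, by simp⟩
    · obtain ⟨m, hm, q', -, hq⟩ := ih hi
      refine ⟨m, hm, (Walk.cons h q').bypass, (Walk.bypass_isPath _), fun x hx hxS => ?_⟩
      have hx' := Walk.support_bypass_subset_support _ hx
      rw [Walk.support_cons, List.mem_cons] at hx'
      rcases hx' with rfl | hx'
      · exact absurd hxS hu
      · exact hq x hx' hxS

theorem Walk.IsPath.append_of_inter {u v w : ι} {p : G.Walk u v} {q : G.Walk v w} (hp : p.IsPath)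
    (hq : q.IsPath) (h : ∀ x ∈ p.support, x ∈ q.support → x = v) : (p.append q).IsPath := by
  rw [Walk.isPath_def, Walk.support_append, List.nodup_append]
  have hq' := hq.support_nodup
  rw [← Walk.cons_tail_support, List.nodup_cons] at hq'
  refine ⟨hp.support_nodup, hq'.2, fun a ha b hb hab => ?_⟩
  subst hab
  have := h a ha (List.mem_of_mem_tail hb)
  subst this
  exact hq'.1 hb

/-- Any three nodes of a connected graph lie pairwise on paths through a common node. -/
theorem Connected.exists_median (hG : G.Connected) (i j l : ι) :
    ∃ (m : ι) (p : G.Walk i j) (q : G.Walk l i) (r : G.Walk l j), p.IsPath ∧ q.IsPath ∧ r.IsPath ∧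
      m ∈ p.support ∧ m ∈ q.support ∧ m ∈ r.support := by
  classical
  obtain ⟨p, hp⟩ := (hG i j).exists_isPath
  obtain ⟨q⟩ := hG l i
  -- The first point of `p` met from `l` is the median: continuing along `p` in either direction
  -- never revisits `q'`.
  obtain ⟨m, hm, q', hq', hmeet⟩ := q.exists_isPath_to_set {x | x ∈ p.support} p.start_mem_support
  refine ⟨m, p, q'.append (p.takeUntil m hm).reverse, q'.append (p.dropUntil m hm), hp,
    hq'.append_of_inter (hp.takeUntil hm).reverse ?_, hq'.append_of_inter (hp.dropUntil hm) ?_, hm,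
    ?_, ?_⟩
  · intro x hx hx'
    rw [Walk.support_reverse, List.mem_reverse] at hx'
    exact hmeet x hx (Walk.support_takeUntil_subset_support _ _ hx')
  · intro x hx hx'
    exact hmeet x hx (Walk.support_dropUntil_subset_support _ _ hx')
  · exact (Walk.mem_support_append_iff _ _).2 (.inl q'.end_mem_support)
  · exact (Walk.mem_support_append_iff _ _).2 (.inl q'.end_mem_support)

end Median

variable {V : Type*} {G : SimpleGraph V}

/-- The three edges of a triangle lie in three bags; the bag at their median contains all three
vertices. -/
theorem TreeDecomposition.two_le_width {ι : Type} [Fintype ι] (D : G.TreeDecomposition ι)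
    {a b c : V} (hab : G.Adj a b) (hbc : G.Adj b c) (hac : G.Adj a c) : 2 ≤ D.width := by
  classical
  obtain ⟨i, hia, hib⟩ := D.edge_mem a b hab
  obtain ⟨j, hjb, hjc⟩ := D.edge_mem b c hbc
  obtain ⟨l, hla, hlc⟩ := D.edge_mem a c hac
  obtain ⟨m, p, q, r, hp, hq, hr, hmp, hmq, hmr⟩ := D.isTree.connected.exists_median i j l
  have hb := D.path_mem i j p hp m hmp b hib hjb
  have ha := D.path_mem l i q hq m hmq a hla hia
  have hc := D.path_mem l j r hr m hmr c hlc hjc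
  have h3 : ({a, b, c} : Finset V).card = 3 := Finset.card_eq_three.2
    ⟨a, b, c, hab.ne, hac.ne, hbc.ne, rfl⟩
  have hsub : ({a, b, c} : Finset V) ⊆ D.bag m := by
    intro x hx
    simp only [Finset.mem_insert, Finset.mem_singleton] at hx
    rcases hx with rfl | rfl | rfl <;> assumption
  have h1 := Finset.card_le_card hsub
  have h2 : (D.bag m).card ≤ Finset.univ.sup fun i => (D.bag i).card :=
    Finset.le_sup (f := fun i => (D.bag i).card) (Finset.mem_univ m)
  rw [TreeDecomposition.width]
  omega

/-! ### Tree decompositions from a parent function -/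

section Parent

variable {ι : Type} (par : ι → ι) (root : ι)

/-- The tree in which every node other than the root is joined to its parent. -/
def parentTree : SimpleGraph ι := fromRel fun i j => i ≠ root ∧ par i = j

variable {par root} {depth : ι → ℕ}

theorem parentTree_adj_parent (hdepth : ∀ i ≠ root, depth (par i) < depth i) {i : ι}
    (hi : i ≠ root) : (parentTree par root).Adj i (par i) := by
  rw [parentTree, fromRel_adj]
  exact ⟨fun h => (hdepth i hi).ne (congrArg depth h.symm), .inl ⟨hi, rfl⟩⟩

/-- If a set of nodes contains with every node but one also its parent, then every node of the set
is joined to that one within the set. -/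
theorem exists_walk_parentTree (hdepth : ∀ i ≠ root, depth (par i) < depth i) (S : Set ι) (top : ι)
    (hS : ∀ i ∈ S, i = top ∨ (i ≠ root ∧ par i ∈ S)) (i : ι) (hi : i ∈ S) :
    ∃ p : (parentTree par root).Walk i top, ∀ x ∈ p.support, x ∈ S := by
  induction hd : depth i using Nat.strong_induction_on generalizing i with
  | _ d ih =>
    rcases hS i hi with rfl | ⟨hr, hp⟩
    · exact ⟨.nil, by simpa using hi⟩
    · obtain ⟨p, hpS⟩ := ih _ (hd ▸ hdepth i hr) (par i) hp rfl
      refine ⟨.cons (parentTree_adj_parent hdepth hr) p, fun x hx => ?_⟩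
      rw [Walk.support_cons, List.mem_cons] at hx
      rcases hx with rfl | hx
      · exact hi
      · exact hpS x hx

theorem isTree_parentTree [Finite ι] (hdepth : ∀ i ≠ root, depth (par i) < depth i) :
    (parentTree par root).IsTree := by
  classical
  have := Fintype.ofFinite ι
  have hr : ∀ i, (parentTree par root).Reachable i root := by
    intro i
    obtain ⟨p, -⟩ := exists_walk_parentTree hdepth Set.univ root
      (fun j _ => (eq_or_ne j root).imp_right fun h => ⟨h, trivial⟩) i trivial
    exact p.reachable
  have hconn : (parentTree par root).Connected :=
    (connected_iff _).2 ⟨fun i j => (hr i).trans (hr j).symm, ⟨root⟩⟩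
  rw [isTree_iff_connected_and_card]
  refine ⟨hconn, le_antisymm ?_ hconn.card_vert_le_card_edgeSet_add_one⟩
  -- Every edge joins a non-root node to its parent, so there are at most `Nat.card ι - 1` edges,
  -- and a connected graph with so few is a tree.
  have hsub : (parentTree par root).edgeSet ⊆ (fun i => s(i, par i)) '' {i | i ≠ root} := by
    intro e he
    induction e with | _ x y
    rw [mem_edgeSet, parentTree, fromRel_adj] at he
    rcases he.2 with ⟨h, rfl⟩ | ⟨h, rfl⟩
    · exact ⟨x, h, rfl⟩
    · exact ⟨y, h, Sym2.eq_swap⟩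
  have h1 := Set.ncard_le_ncard hsub (Set.toFinite _)
  have h2 := Set.ncard_image_le (f := fun i => s(i, par i)) (Set.toFinite {i | i ≠ root})
  have h3 : ({i | i ≠ root} : Set ι).ncard + 1 = Nat.card ι := by
    have := Set.ncard_add_ncard_compl ({root} : Set ι)
    rw [Set.ncard_singleton] at this
    rw [← this, add_comm]
    rfl
  rw [Nat.card_coe_set_eq]
  omega

/-- The tree decomposition given by a parent function and bags such that every vertex has a
topmost bag. -/
def TreeDecomposition.ofParent [Finite ι] (hdepth : ∀ i ≠ root, depth (par i) < depth i)
    (bag : ι → Finset V) (vertex_mem : ∀ v : V, ∃ i, v ∈ bag i)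
    (edge_mem : ∀ u v : V, G.Adj u v → ∃ i, u ∈ bag i ∧ v ∈ bag i)
    (htop : ∀ v, ∃ top, ∀ i, v ∈ bag i → i = top ∨ (i ≠ root ∧ v ∈ bag (par i))) :
    G.TreeDecomposition ι where
  tree := parentTree par root
  isTree := isTree_parentTree hdepth
  bag := bag
  vertex_mem := vertex_mem
  edge_mem := edge_mem
  path_mem := by
    classical
    intro i l p hp j hj v hi hl
    obtain ⟨top, htop⟩ := htop v
    obtain ⟨q, hq⟩ := exists_walk_parentTree hdepth {i | v ∈ bag i} top htop i hi
    obtain ⟨r, hr⟩ := exists_walk_parentTree hdepth {i | v ∈ bag i} top htop l hl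
    -- The bags containing `v` are joined through its topmost bag, and the unique tree path is a
    -- shortcut of that walk.
    have huniq : p = (q.append r.reverse).bypass :=
      ((isTree_parentTree hdepth).existsUnique_path i l).unique hp ((Walk.bypass_isPath _))
    rw [huniq] at hj
    have hj' := Walk.support_bypass_subset_support _ hj
    rw [Walk.mem_support_append_iff, Walk.support_reverse, List.mem_reverse] at hj'
    exact hj'.elim (hq j) (hr j)

end Parent

end SimpleGraph

/-! ### A width-two decomposition of the pattern -/

namespace patternGraph

variable {k : ℕ}

/-- Nodes of the tree of a tree decomposition of the pattern: a path that triangulates the cycle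
through the four triangles, a node for each triangle, and two nodes for each path of length three. -/
abbrev BagIndex (k : ℕ) : Type := Fin 6 ⊕ (Fin 2 × Fin 2) ⊕ (Fin 2 × Fin k) ⊕ (Fin 2 × Fin k)

/-- The parent function of the tree decomposition. -/
def bagParent : BagIndex k → BagIndex k
  | .inl j => .inl (![0, 0, 1, 2, 3, 4] j)
  | .inr (.inl (a, i)) => .inl (if i = 0 then (if a = 0 then 0 else 1) else (if a = 0 then 5 else 3))
  | .inr (.inr (.inl (i, _))) => .inl (if i = 0 then 0 else 4)
  | .inr (.inr (.inr (i, p))) => .inr (.inr (.inl (i, p)))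

/-- A measure that decreases from a node to its parent. -/
def bagDepth : BagIndex k → ℕ
  | .inl j => j
  | .inr (.inl _) => 10
  | .inr (.inr (.inl _)) => 10
  | .inr (.inr (.inr _)) => 11

/-- The bags of the tree decomposition. -/
def bag : BagIndex k → Finset (PatternVertex k)
  | .inl j =>
      -- The ring of the eight triangle nodes with labels `0` and `1`, with each bundle of paths
      -- shortened to one edge, is triangulated as a fan from this apex.
      {.inl (0, 0, 0),
        (![.inl (0, 0, 1), .inl (1, 0, 1), .inl (1, 0, 0), .inl (1, 1, 0), .inl (1, 1, 1),
          .inl (0, 1, 1)] : Fin 6 → PatternVertex k) j,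
        (![.inl (1, 0, 1), .inl (1, 0, 0), .inl (1, 1, 0), .inl (1, 1, 1), .inl (0, 1, 1),
          .inl (0, 1, 0)] : Fin 6 → PatternVertex k) j}
  | .inr (.inl (a, i)) => {.inl (a, i, 0), .inl (a, i, 1), .inl (a, i, 2)}
  | .inr (.inr (.inl (i, p))) => {.inl (0, i, 1), .inl (1, i, 1), .inr (0, i, p)}
  | .inr (.inr (.inr (i, p))) => {.inl (1, i, 1), .inr (0, i, p), .inr (1, i, p)}

/-- The topmost bag that contains a given vertex. -/
def topBag : PatternVertex k → BagIndex k
  | .inl (a, i, l) => if l = 2 then .inr (.inl (a, i)) else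
      .inl (if i = 0 then (if l = 0 ∧ a = 1 then 1 else 0) else
        (if l = 0 then (if a = 0 then 5 else 2) else (if a = 0 then 4 else 3)))
  | .inr (a, i, p) => if a = 0 then .inr (.inr (.inl (i, p))) else .inr (.inr (.inr (i, p)))

theorem bagDepth_parent_lt (i : BagIndex k) (hi : i ≠ .inl 0) :
    bagDepth (bagParent i) < bagDepth i := by
  rcases i with j | ⟨a, i⟩ | ⟨i, p⟩ | ⟨i, p⟩
  · fin_cases j <;> simp [bagDepth, bagParent] at hi ⊢
  · fin_cases a <;> fin_cases i <;> simp [bagDepth, bagParent]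
  · fin_cases i <;> simp [bagDepth, bagParent]
  · simp [bagDepth, bagParent]

theorem eq_topBag_or (v : PatternVertex k) (i : BagIndex k) (hv : v ∈ bag i) :
    i = topBag v ∨ (i ≠ .inl 0 ∧ v ∈ bag (bagParent i)) := by
  rcases i with j | ⟨a, i⟩ | ⟨i, p⟩ | ⟨i, p⟩ <;>
    simp only [bag, Finset.mem_insert, Finset.mem_singleton] at hv
  · fin_cases j <;> rcases hv with rfl | rfl | rfl <;> simp [topBag, bag, bagParent]
  · fin_cases a <;> fin_cases i <;> rcases hv with rfl | rfl | rfl <;>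
      simp [topBag, bag, bagParent]
  · fin_cases i <;> rcases hv with rfl | rfl | rfl <;> simp [topBag, bag, bagParent]
  · rcases hv with rfl | rfl | rfl <;> simp [topBag, bag, bagParent]

theorem exists_mem_bag_of_adj (u v : PatternVertex k) (h : (patternGraph k).Adj u v) :
    ∃ i, u ∈ bag i ∧ v ∈ bag i := by
  rcases u with ⟨a, i, l⟩ | ⟨a, i, p⟩ <;> rcases v with ⟨a', i', l'⟩ | ⟨a', i', p'⟩ <;>
    simp only [patternGraph] at h
  · obtain ⟨rfl, ⟨rfl, -⟩ | ⟨hi, rfl, rfl⟩⟩ := h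
    · refine ⟨.inr (.inl (a, i)), ?_, ?_⟩
      · fin_cases l <;> simp [bag]
      · fin_cases l' <;> simp [bag]
    · refine ⟨.inl (if a = 0 then 5 else 2), ?_⟩
      fin_cases a <;> fin_cases i <;> fin_cases i' <;> simp [bag] at hi ⊢
  · obtain ⟨rfl, rfl, rfl⟩ := h
    fin_cases a
    · exact ⟨.inr (.inr (.inl (i, p'))), by simp [bag]⟩
    · exact ⟨.inr (.inr (.inr (i, p'))), by simp [bag]⟩
  · obtain ⟨rfl, rfl, rfl⟩ := h
    fin_cases a
    · exact ⟨.inr (.inr (.inl (i, p))), by simp [bag]⟩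
    · exact ⟨.inr (.inr (.inr (i, p))), by simp [bag]⟩
  · obtain ⟨ha, rfl, rfl⟩ := h
    refine ⟨.inr (.inr (.inr (i, p))), ?_⟩
    fin_cases a <;> fin_cases a' <;> simp [bag] at ha ⊢

/-- A tree decomposition of the pattern of width two. -/
def treeDecomposition (k : ℕ) : (patternGraph k).TreeDecomposition (BagIndex k) :=
  .ofParent bagDepth_parent_lt bag
    (fun v => (exists_adj v).elim fun w h => (exists_mem_bag_of_adj v w h).imp fun _ hi => hi.1)
    exists_mem_bag_of_adj fun v => ⟨topBag v, eq_topBag_or v⟩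

theorem treewidth_eq_two (k : ℕ) : (patternGraph k).treewidth = 2 := by
  have hlow : ∀ (ι : Type) [Fintype ι] (D : (patternGraph k).TreeDecomposition ι),
      2 ≤ D.width := fun ι _ D =>
    D.two_le_width (a := .inl (0, 0, 0)) (b := .inl (0, 0, 1)) (c := .inl (0, 0, 2))
      ⟨rfl, .inl ⟨rfl, by decide⟩⟩ ⟨rfl, .inl ⟨rfl, by decide⟩⟩ ⟨rfl, .inl ⟨rfl, by decide⟩⟩
  have hup : (treeDecomposition k).width ≤ 2 := by
    rw [SimpleGraph.TreeDecomposition.width, Nat.sub_le_iff_le_add, Finset.sup_le_iff]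
    rintro (j | ⟨a, i⟩ | ⟨i, p⟩ | ⟨i, p⟩) - <;> exact Finset.card_le_three
  have hmem : 2 ∈ {w | ∃ (ι : Type) (_ : Fintype ι)
      (D : (patternGraph k).TreeDecomposition ι), D.width = w} :=
    ⟨BagIndex k, inferInstance, treeDecomposition k, le_antisymm hup (hlow _ _)⟩
  -- Nonemptiness is needed for the lower bound, since `sInf ∅ = 0` on `ℕ`.
  refine le_antisymm (Nat.sInf_le hmem) (le_csInf ⟨2, hmem⟩ ?_)
  rintro w ⟨ι, _, D, rfl⟩
  exact hlow ι D

end patternGraph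

/-! ### Series-parallel structure -/

namespace SimpleGraph

variable {V : Type*} {G : SimpleGraph V}

theorem exists_isTwoTerminalSP_triangle {a b c : V} (hab : G.Adj a b) (hac : G.Adj a c)
    (hcb : G.Adj c b) : ∃ S : G.Subgraph, IsTwoTerminalSP S a b ∧ S.verts = {a, b, c} ∧
      S.Adj a b ∧ S.Adj a c ∧ S.Adj c b := by
  refine ⟨G.subgraphOfAdj hab ⊔ (G.subgraphOfAdj hac ⊔ G.subgraphOfAdj hcb),
    -- The edge from `a` to `b` is parallel to the two-edge path through `c`.
    (IsTwoTerminalSP.edge hab).parallel ((IsTwoTerminalSP.edge hac).series (.edge hcb) ?_) ?_,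
    ?_, ?_⟩
  · have := hab.ne
    have := hac.ne
    have := hcb.ne
    ext x
    simp
    grind
  · ext x
    simp
    grind
  · ext x
    simp
    grind
  · simp

theorem exists_isTwoTerminalSP_path {a x y b : V} (hax : G.Adj a x) (hxy : G.Adj x y)
    (hyb : G.Adj y b) (hab : a ≠ b) (hay : a ≠ y) (hxb : x ≠ b) :
    ∃ S : G.Subgraph, IsTwoTerminalSP S a b ∧ S.verts = {a, b, x, y} ∧
      S.Adj a x ∧ S.Adj x y ∧ S.Adj y b := by
  have := hax.ne
  have := hxy.ne
  have := hyb.ne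
  refine ⟨G.subgraphOfAdj hax ⊔ (G.subgraphOfAdj hxy ⊔ G.subgraphOfAdj hyb),
    (IsTwoTerminalSP.edge hax).series ((IsTwoTerminalSP.edge hxy).series (.edge hyb) ?_) ?_,
    ?_, ?_⟩
  · ext z
    simp
    grind
  · ext z
    simp
    grind
  · ext z
    simp
    grind
  · simp

theorem exists_isTwoTerminalSP_paths {κ : Type*} {a b : V} {x y : κ → V}
    (hax : ∀ p, G.Adj a (x p)) (hxy : ∀ p, G.Adj (x p) (y p)) (hyb : ∀ p, G.Adj (y p) b)
    (hab : a ≠ b) (hay : ∀ p, a ≠ y p) (hxb : ∀ p, x p ≠ b) (hx : Function.Injective x)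
    (hy : Function.Injective y) (hne : ∀ p q, x p ≠ y q) (s : Finset κ) (hs : s.Nonempty) :
    ∃ S : G.Subgraph, IsTwoTerminalSP S a b ∧
      (∀ w, w ∈ S.verts ↔ w = a ∨ w = b ∨ ∃ p ∈ s, w = x p ∨ w = y p) ∧
      ∀ p ∈ s, S.Adj a (x p) ∧ S.Adj (x p) (y p) ∧ S.Adj (y p) b := by
  have hpath := fun p => exists_isTwoTerminalSP_path (hax p) (hxy p) (hyb p) hab (hay p) (hxb p)
  induction hs using Finset.Nonempty.cons_induction with
  | singleton p =>
    obtain ⟨S, hS, hv, hadj⟩ := hpath p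
    exact ⟨S, hS, fun w => by simp [hv], by simpa using hadj⟩
  | cons p s hp hs ih =>
    obtain ⟨S, hS, hv, hadj⟩ := hpath p
    obtain ⟨S', hS', hv', hadj'⟩ := ih
    refine ⟨S ⊔ S', hS.parallel hS' ?_, fun w => ?_, fun q hq => ?_⟩
    · ext w
      rw [Set.mem_inter_iff, hv, hv']
      simp only [Set.mem_insert_iff, Set.mem_singleton_iff]
      constructor
      · rintro ⟨h | h | h | h, h' | h' | ⟨q, hq, h' | h'⟩⟩ <;> try tauto
        · exact absurd (hx (h.symm.trans h')) (fun e => hp (e ▸ hq))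
        · exact absurd (h.symm.trans h') (hne p q)
        · exact absurd (h'.symm.trans h) (hne q p)
        · exact absurd (hy (h.symm.trans h')) (fun e => hp (e ▸ hq))
      · tauto
    · rw [Subgraph.verts_sup, Set.mem_union, hv, hv']
      simp only [Set.mem_insert_iff, Set.mem_singleton_iff, Finset.mem_cons]
      grind
    · simp only [Subgraph.sup_adj]
      rcases Finset.mem_cons.1 hq with rfl | hq
      · exact ⟨.inl hadj.1, .inl hadj.2.1, .inl hadj.2.2⟩
      · obtain ⟨h1, h2, h3⟩ := hadj' q hq
        exact ⟨.inr h1, .inr h2, .inr h3⟩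

end SimpleGraph

namespace patternGraph

variable {k : ℕ}

theorem adj_triangle (a i : Fin 2) {l l' : Fin 3} (h : l ≠ l') :
    (patternGraph k).Adj (.inl (a, i, l)) (.inl (a, i, l')) := ⟨rfl, .inl ⟨rfl, h⟩⟩

theorem adj_bridge (a : Fin 2) : (patternGraph k).Adj (.inl (a, 0, 0)) (.inl (a, 1, 0)) :=
  ⟨rfl, .inr ⟨by decide, rfl, rfl⟩⟩

theorem exists_isTwoTerminalSP_triangle (a i : Fin 2) (l l' l'' : Fin 3) (h : l ≠ l')
    (h' : l ≠ l'') (h'' : l'' ≠ l') : ∃ S : (patternGraph k).Subgraph,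
      SimpleGraph.IsTwoTerminalSP S (.inl (a, i, l)) (.inl (a, i, l')) ∧
      (∀ w, w ∈ S.verts ↔ ∃ l, w = .inl (a, i, l)) ∧
      ∀ l l', l ≠ l' → S.Adj (.inl (a, i, l)) (.inl (a, i, l')) := by
  obtain ⟨S, hS, hv, h1, h2, h3⟩ := SimpleGraph.exists_isTwoTerminalSP_triangle
    (adj_triangle (k := k) a i h) (adj_triangle a i h') (adj_triangle a i h'')
  have hcov : ∀ m : Fin 3, m = l ∨ m = l' ∨ m = l'' := by
    clear * - h h' h''
    revert l l' l''
    decide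
  refine ⟨S, hS, fun w => ?_, fun m m' hm => ?_⟩
  · rw [hv]
    constructor
    · rintro (rfl | rfl | rfl) <;> exact ⟨_, rfl⟩
    · rintro ⟨m, rfl⟩
      rcases hcov m with rfl | rfl | rfl <;> simp
  · rcases hcov m with rfl | rfl | rfl <;> rcases hcov m' with rfl | rfl | rfl <;>
      first | exact absurd rfl hm | assumption | exact SimpleGraph.Subgraph.Adj.symm ‹_›

theorem exists_isTwoTerminalSP_paths (hk : 1 ≤ k) (i a a' : Fin 2) (ha : a ≠ a') :
    ∃ S : (patternGraph k).Subgraph,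
      SimpleGraph.IsTwoTerminalSP S (.inl (a, i, 1)) (.inl (a', i, 1)) ∧
      (∀ w, w ∈ S.verts ↔ (∃ b, w = .inl (b, i, 1)) ∨ ∃ b p, w = .inr (b, i, p)) ∧
      (∀ b p, S.Adj (.inl (b, i, 1)) (.inr (b, i, p))) ∧
      ∀ b b' p, b ≠ b' → S.Adj (.inr (b, i, p)) (.inr (b', i, p)) := by
  have hcov : ∀ b : Fin 2, b = a ∨ b = a' := by
    revert a a'
    decide
  obtain ⟨S, hS, hv, hadj⟩ := SimpleGraph.exists_isTwoTerminalSP_paths (G := patternGraph k)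
    (a := .inl (a, i, 1)) (b := .inl (a', i, 1)) (x := fun p : Fin k => .inr (a, i, p))
    (y := fun p : Fin k => .inr (a', i, p)) (fun p => ⟨rfl, rfl, rfl⟩) (fun p => ⟨ha, rfl, rfl⟩)
    (fun p => ⟨rfl, rfl, rfl⟩) (by simpa using ha) (by simp) (by simp) (fun p q h => by simpa using h)
    (fun p q h => by simpa using h) (by simpa using fun _ => ha) Finset.univ
    ⟨⟨0, hk⟩, Finset.mem_univ _⟩
  refine ⟨S, hS, fun w => ?_, fun b p => ?_, fun b b' p hb => ?_⟩
  · rw [hv]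
    constructor
    · rintro (rfl | rfl | ⟨p, -, rfl | rfl⟩)
      exacts [.inl ⟨_, rfl⟩, .inl ⟨_, rfl⟩, .inr ⟨_, _, rfl⟩, .inr ⟨_, _, rfl⟩]
    · rintro (⟨b, rfl⟩ | ⟨b, p, rfl⟩) <;> rcases hcov b with rfl | rfl <;> simp
  · obtain ⟨h1, -, h3⟩ := hadj p (Finset.mem_univ _)
    rcases hcov b with rfl | rfl
    exacts [h1, h3.symm]
  · obtain ⟨-, h2, -⟩ := hadj p (Finset.mem_univ _)
    rcases hcov b with rfl | rfl <;> rcases hcov b' with rfl | rfl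
    exacts [absurd rfl hb, h2, h2.symm, absurd rfl hb]

theorem isSeriesParallel (hk : 1 ≤ k) : (patternGraph k).IsSeriesParallel := by
  obtain ⟨T₀₀, s₀₀, v₀₀, a₀₀⟩ := exists_isTwoTerminalSP_triangle (k := k) 0 0 0 1 2 (by decide)
    (by decide) (by decide)
  obtain ⟨T₁₀, s₁₀, v₁₀, a₁₀⟩ := exists_isTwoTerminalSP_triangle (k := k) 1 0 1 0 2 (by decide)
    (by decide) (by decide)
  obtain ⟨T₁₁, s₁₁, v₁₁, a₁₁⟩ := exists_isTwoTerminalSP_triangle (k := k) 1 1 0 1 2 (by decide)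
    (by decide) (by decide)
  obtain ⟨T₀₁, s₀₁, v₀₁, a₀₁⟩ := exists_isTwoTerminalSP_triangle (k := k) 0 1 1 0 2 (by decide)
    (by decide) (by decide)
  obtain ⟨P₀, q₀, w₀, b₀, c₀⟩ := exists_isTwoTerminalSP_paths hk 0 0 1 (by decide)
  obtain ⟨P₁, q₁, w₁, b₁, c₁⟩ := exists_isTwoTerminalSP_paths hk 1 1 0 (by decide)
  have e₁ := SimpleGraph.IsTwoTerminalSP.edge (adj_bridge (k := k) 1)
  have e₀ := SimpleGraph.IsTwoTerminalSP.edge (adj_bridge (k := k) 0)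
  -- Going around the ring from node `0` of `A₁` to node `0` of `A₂` (zero-based labels): triangle,
  -- paths, triangle, the other bridge, triangle, paths, triangle. The bridge between the two
  -- terminals closes the ring in parallel.
  have r := e₀.parallel (s₀₀.series (q₀.series (s₁₀.series (e₁.series (s₁₁.series
    (q₁.series s₀₁ ?_) ?_) ?_) ?_) ?_) ?_) ?_
  · refine ⟨_, _, Eq.subst (motive := fun S => SimpleGraph.IsTwoTerminalSP S _ _) ?_ r⟩
    refine SimpleGraph.Subgraph.ext ?_ ?_
    · refine Set.eq_univ_of_forall fun w => ?_
      simp only [SimpleGraph.Subgraph.verts_sup, Set.mem_union, v₀₀, v₁₀, v₁₁, v₀₁, w₀, w₁]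
      rcases w with ⟨a, i, l⟩ | ⟨a, i, p⟩ <;> fin_cases a <;> fin_cases i <;> simp
    · funext u v
      refine propext ⟨fun h => SimpleGraph.Subgraph.adj_sub _ h, fun h => ?_⟩
      rw [SimpleGraph.Subgraph.top_adj] at h
      simp only [SimpleGraph.Subgraph.sup_adj]
      rcases u with ⟨a, i, l⟩ | ⟨a, i, p⟩ <;> rcases v with ⟨a', i', l'⟩ | ⟨a', i', p'⟩ <;>
        simp only [patternGraph] at h
      · obtain ⟨rfl, ⟨rfl, h⟩ | ⟨hi, rfl, rfl⟩⟩ := h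
        · fin_cases a <;> fin_cases i
          · simp [a₀₀ _ _ h]
          · simp [a₀₁ _ _ h]
          · simp [a₁₀ _ _ h]
          · simp [a₁₁ _ _ h]
        · fin_cases a <;> fin_cases i <;> fin_cases i' <;> simp at hi ⊢
      · obtain ⟨rfl, rfl, rfl⟩ := h
        fin_cases i
        · simp [b₀]
        · simp [b₁]
      · obtain ⟨rfl, rfl, rfl⟩ := h
        fin_cases i
        · simp [(b₀ _ _).symm]
        · simp [(b₁ _ _).symm]
      · obtain ⟨h, rfl, rfl⟩ := h
        fin_cases i
        · simp [c₀ _ _ _ h]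
        · simp [c₁ _ _ _ h]
  all_goals
    ext w
    simp only [SimpleGraph.Subgraph.verts_sup, Set.mem_inter_iff, Set.mem_union, v₀₀, v₁₀, v₁₁, v₀₁,
      w₀, w₁, SimpleGraph.subgraphOfAdj_verts, Set.mem_insert_iff, Set.mem_singleton_iff]
    rcases w with ⟨a, i, l⟩ | ⟨a, i, p⟩ <;> fin_cases a <;> fin_cases i <;> simp

end patternGraph

theorem mainTheorem2 (k : ℕ) (hk : 2 ≤ k) :
    (patternGraph k).IsSeriesParallel ∧
    (patternGraph k).treewidth = 2 ∧
    -- a family of lower bound graphs for detection and for induced detection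
    (∃ (m C : ℕ → ℕ)
        (G : ∀ n : ℕ, (Fin (m n) → Bool) → (Fin (m n) → Bool) → SimpleGraph (Fin n)),
      (fun n => (m n : ℝ)) =Θ[atTop] (fun n : ℕ => (n : ℝ) ^ 2) ∧
      (fun n => (C n : ℝ)) =Θ[atTop] (fun n : ℕ => (n : ℝ) ^ (1 / (k : ℝ))) ∧
      IsLowerBoundFamily (fun n g => ¬ HasCopy (patternGraph k) n g) m C
        (fun n => disj (m n)) G ∧
      IsLowerBoundFamily (fun n g => ¬ HasInducedCopy (patternGraph k) n g) m C
        (fun n => disj (m n)) G) ∧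
    -- round lower bound with arbitrary bandwidth `B`
    (∃ c : ℝ, 0 < c ∧ ∃ n₀ : ℕ, ∀ n ≥ n₀, ∀ B T : ℕ,
      ∀ P : SimpleGraph (Fin n) → Prop,
        P = HasCopy (patternGraph k) n ∨ P = HasInducedCopy (patternGraph k) n →
        DeterministicallySolvable P B T ∨ RandomizedSolvable P B T →
        c * (n : ℝ) ^ (2 - 1 / (k : ℝ)) ≤ (T : ℝ) * (B : ℝ)) ∧
    -- round lower bound with bandwidth `O(log n)`
    (∀ β : ℝ, 0 < β → ∃ c : ℝ, 0 < c ∧ ∃ n₀ : ℕ, ∀ n ≥ n₀, ∀ B T : ℕ,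
      (B : ℝ) ≤ β * Real.log n →
      ∀ P : SimpleGraph (Fin n) → Prop,
        P = HasCopy (patternGraph k) n ∨ P = HasInducedCopy (patternGraph k) n →
        DeterministicallySolvable P B T ∨ RandomizedSolvable P B T →
        c * (n : ℝ) ^ (2 - 1 / (k : ℝ)) / Real.log n ≤ (T : ℝ)) := by
  have hk1 : 1 ≤ k := by omega
  exact ⟨patternGraph.isSeriesParallel hk1, patternGraph.treewidth_eq_two k,
    exists_isLowerBoundFamily hk1, exists_round_lower_bound hk1, exists_round_lower_bound_log hk1⟩
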